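/- Let $d\ge 4$. There is $\epsilon_0>0$, depending only on $d$, such that for every regular $d$-simplex $\Sigma=[u'_1,\dots,u'_{d+1}]\subset\mathbb R^d$ and every $0<\epsilon<\epsilon_0$ the following construction is well defined and has the properties below. (Here $[\dots]$ denotes a convex hull.) Construction. For $1\le i\le d-1$ let $p_i$ be the barycenter of the $(d-2)$-face of $\Sigma$ with vertices $u'_j$, $j\in\{1,\dots,d\}\setminus\{i\}$, and let $u_i=p_i+\epsilon(p_i-u'_{d+1})$. For $I\subseteq\{1,\dots,d-1\}$ let $A_I$ be the affine hull of $\{u_i: i\in I\}\cup\{u'_j: j\in\{1,\dots,d-1\}\setminus I\}$. For each $1\le k\le d-2$ the intersection of all $A_I$ with $|I|=k$ is a single point $a_k$. Put $v_1=u'_d$ and, for $i=2,\dots,d-2$ successively, let $v_i$ be any point of the relative interior of the segment $[a_i,v_{i-1}]$. Let $$P^d=\operatorname{conv}\{u'_1,\dots,u'_{d+1},\,u_1,\dots,u_{d-1},\,v_2,\dots,v_{d-2}\}.$$ Properties. For every such choice of $v_2,\dots,v_{d-2}$, $P^d$ is a $d$-polytope with exactly $3(d-1)$ vertices; it is $(d-2)$-simplicial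 (every $(d-2)$-face is a simplex) and $2$-simple (every $(d-3)$-face is contained in exactly $3$ facets). There are exactly two pairs $(F,w)$ consisting of a facet $F$ of $P^d$ that is a simplex and a simple vertex $w\notin F$ of $P^d$ (a vertex contained in exactly $d$ facets), namely $$([u_1,\dots,u_{d-1},v_{d-2}],\,u'_{d+1})\quad\text{and}\quad([u'_1,\dots,u'_{d-1},u'_{d+1}],\,v_{d-2}).$$ -/

import Mathlib

namespace PolytopeConstruction

section Faces

variable {E : Type*} [NormedAddCommGroup E] [NormedSpace ℝ E]

/-- The dimension of (the affine span of) a nonempty set. -/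
noncomputable def dim (P : Set E) : ℕ := Module.finrank ℝ (vectorSpan ℝ P)

/-- `F` is a `k`-dimensional (nonempty) face of the polytope `P`: either `P` itself or the
intersection of `P` with a supporting hyperplane. -/
def IsFaceOfDim (P : Set E) (k : ℕ) (F : Set E) : Prop :=
  IsExposed ℝ P F ∧ F.Nonempty ∧ dim F = k

/-- A facet is a face of codimension one. -/
def IsFacet (P F : Set E) : Prop :=
  ∃ k, IsFaceOfDim P k F ∧ k + 1 = dim P

/-- A vertex is (the unique point of) a face of dimension zero. -/
def IsVertex (P : Set E) (x : E) : Prop := IsFaceOfDim P 0 {x}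

/-- A simplex is the convex hull of finitely many (at least one) affinely independent points. -/
def IsSimplex (F : Set E) : Prop :=
  ∃ (k : ℕ) (s : Affine.Simplex ℝ E k), F = convexHull ℝ (Set.range s.points)

/-- `P` is `i`-simplicial if all of its `i`-faces are simplices. -/
def IsSimplicial (i : ℕ) (P : Set E) : Prop :=
  ∀ F, IsFaceOfDim P i F → IsSimplex F

/-- A `d`-polytope `P` is `i`-simple if every `(d - i - 1)`-face is contained in exactly `i + 1`
facets. -/
def IsSimple (i : ℕ) (P : Set E) : Prop :=
  ∀ k F, k + i + 1 = dim P → IsFaceOfDim P k F → {G | IsFacet P G ∧ F ⊆ G}.ncard = i + 1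

/-- A vertex of a `d`-polytope `P` is simple if it belongs to exactly `d` facets. -/
def IsSimpleVertex (P : Set E) (x : E) : Prop :=
  IsVertex P x ∧ {G | IsFacet P G ∧ x ∈ G}.ncard = dim P

end Faces

section Construction

variable {d : ℕ}

/-- The vertices `u'₁, …, u'_{d+1}` of a `d`-simplex, numbered from `1` to `d + 1`
(other indices are not used). -/
def u' (S : Affine.Simplex ℝ (EuclideanSpace ℝ (Fin d)) d) (j : ℕ) : EuclideanSpace ℝ (Fin d) :=
  S.points (Fin.ofNat (d + 1) (j - 1))

/-- `pᵢ` is the barycenter of the `(d-2)`-face of the simplex that misses `u'ᵢ` and `u'_{d+1}`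
(`1 ≤ i ≤ d - 1`). -/
noncomputable def p (S : Affine.Simplex ℝ (EuclideanSpace ℝ (Fin d)) d) (i : ℕ) :
    EuclideanSpace ℝ (Fin d) :=
  Finset.centroid ℝ ((Finset.Icc 1 d).erase i) (u' S)

/-- `uᵢ = pᵢ + ε (pᵢ - u'_{d+1})` (`1 ≤ i ≤ d - 1`). -/
noncomputable def u (S : Affine.Simplex ℝ (EuclideanSpace ℝ (Fin d)) d) (ε : ℝ) (i : ℕ) :
    EuclideanSpace ℝ (Fin d) :=
  p S i + ε • (p S i - u' S (d + 1))

/-- The affine hull of the face `H_I` of the `(d-1)`-cross-polytope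
`CP = [u₁, …, u_{d-1}, u'₁, …, u'_{d-1}]` with the vertices `uᵢ` (`i ∈ I`) and
`u'ⱼ` (`j ∈ {1, …, d - 1} \ I`). -/
noncomputable def affH (S : Affine.Simplex ℝ (EuclideanSpace ℝ (Fin d)) d) (ε : ℝ)
    (I : Finset ℕ) : AffineSubspace ℝ (EuclideanSpace ℝ (Fin d)) :=
  affineSpan ℝ (u S ε '' (I : Set ℕ) ∪ u' S '' ((Finset.Icc 1 (d - 1) \ I : Finset ℕ) : Set ℕ))

/-- `a₁, …, a_{d-2}` is the sequence of points associated with `CP`: the affine hulls of all faces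
`H_I` with `|I| = k` meet in the single point `a_k`. -/
def IsAssociatedSequence (S : Affine.Simplex ℝ (EuclideanSpace ℝ (Fin d)) d) (ε : ℝ)
    (a : ℕ → EuclideanSpace ℝ (Fin d)) : Prop :=
  ∀ k ∈ Finset.Icc 1 (d - 2),
    (⋂ I ∈ Finset.powersetCard k (Finset.Icc 1 (d - 1)),
      (affH S ε I : Set (EuclideanSpace ℝ (Fin d)))) = {a k}

/-- An admissible choice of `v₁, …, v_{d-2}`: `v₁ = u'_d`, and for `2 ≤ i ≤ d - 2` the point `vᵢ`
lies in the relative interior of the segment `[aᵢ, v_{i-1}]`. -/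
def IsAdmissible (S : Affine.Simplex ℝ (EuclideanSpace ℝ (Fin d)) d)
    (a v : ℕ → EuclideanSpace ℝ (Fin d)) : Prop :=
  v 1 = u' S d ∧ ∀ i ∈ Finset.Icc 2 (d - 2), v i ∈ openSegment ℝ (a i) (v (i - 1))

/-- The polytope `P^d`, the convex hull of `u'₁, …, u'_{d+1}`, `u₁, …, u_{d-1}` and
`v₂, …, v_{d-2}`. -/
noncomputable def polytope (S : Affine.Simplex ℝ (EuclideanSpace ℝ (Fin d)) d) (ε : ℝ)
    (v : ℕ → EuclideanSpace ℝ (Fin d)) : Set (EuclideanSpace ℝ (Fin d)) :=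
  convexHull ℝ (u' S '' Set.Icc 1 (d + 1) ∪ u S ε '' Set.Icc 1 (d - 1) ∪ v '' Set.Icc 2 (d - 2))

end Construction

end PolytopeConstruction

open PolytopeConstruction

/-!
The construction is affine, so regularity of the simplex plays no role, and with `n = d - 1` it
becomes transparent in suitable coordinates. Put `c = (1 + ε) / n`. All segments `[uᵢ, u'ᵢ]` pass
through one point `z`, where `uᵢ - z = -c (u'ᵢ - z)`; with `z` as origin and `u'ᵢ - z`,
`u'_{d+1} - z` as basis the points `u'ᵢ`, `uᵢ` become `eᵢ`, `-c eᵢ` and span a cross-polytope in a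
horizontal hyperplane (`exists_frame`). The affine hull of the cross-polytope facet with negative
vertices `I` is given by one equation, and exchanging two indices shows that `a_k` is the point
`-(e₁ + ⋯ + eₙ) / β_k` with `β_k = k (1 + 1 / c) - n` (`isAssociatedSequence_axisPoint`). For
`ε < 1 / (d - 2)` all `β_k` with `k ≥ 1` are positive. The points `v₀ = u'_{d+1}`, `v₁ = u'_d`,
`v₂, …, v_{d-2}` then form a chain in the plane spanned by the axis and the vertical direction, in
which `v_k` lies on the open segment from `a_k` to `v_{k-1}` (`exists_cap`). The structure `Cap`
records what is needed of this: a point of the chain is `h (e_vert - r (e₁ + ⋯ + eₙ))`, where `r`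
increases along the chain, and the line through `v_{k-1}` and `v_k` passes through `a_k`.

The facets of the polytope are the cross-polytope and, for every `I ⊆ {1, …, n}`, the hull of the
cross-polytope facet of `I` with the apices `v_{|I|-1}` and `v_{|I|}`, as far as these exist. Each
comes with an explicit functional (`exists_facet_functional`). That there are no others, and all
that is needed about the lower-dimensional faces, comes from `face_structure`: a functional whose
maximal face does not contain the whole cross-polytope selects disjoint sets `A` and `B` of
negative and positive vertices, and the sum of its horizontal coefficients determines a real number
`t` with `|A| ≤ t ≤ n - |B|`, both strict unless every index is in `A` or `B`, such that the apices
`v_j` on the face satisfy `j ≤ t ≤ j + 1`. Choosing `I` between `A` and the complement of `B` with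
`|I| = ⌊t⌋` gives a facet containing the face.

The vertices of such a facet are either affinely independent or form a circuit
(`affineIndependent_of_inc_some`), whence faces of codimension at least two are simplices. A face
of dimension `d - 3` thus has `n - 1` vertices, and the bounds on `t` leave a binomial count of the
sets `I` that always gives three (`isSimple_two`). The vertex `v_j` is on `(n + 1).choose (j + 1)`
facets and the vertices of the cross-polytope are on `2 ^ (n - 1) + 1`, so only the two ends of the
chain of apices are simple; by counting vertices, only `I = ∅` and `I = {1, …, n}` give simplices
(`simplex_facet_simple_vertex_pairs`).
-/

namespace CrossPolytopeCap

/-! ### Faces of the convex hull of a finite family -/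

section Faces

variable {E : Type*} [NormedAddCommGroup E] [NormedSpace ℝ E] {ι : Type*} {pt : ι → E}

lemma le_of_mem_convexHull_range {φ : E →L[ℝ] ℝ} {μ : ℝ} (hle : ∀ k, φ (pt k) ≤ μ) {x : E}
    (hx : x ∈ convexHull ℝ (Set.range pt)) : φ x ≤ μ := by
  have : convexHull ℝ (Set.range pt) ⊆ {x | φ x ≤ μ} := by
    apply convexHull_min
    · rintro _ ⟨k, rfl⟩; exact hle k
    · exact convex_halfSpace_le φ.toLinearMap.isLinear μ
  exact this hx

lemma eq_of_mem_convexHull_image {φ : E →L[ℝ] ℝ} {μ : ℝ} {M : Set ι}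
    (hM : ∀ k ∈ M, φ (pt k) = μ) {x : E} (hx : x ∈ convexHull ℝ (pt '' M)) : φ x = μ := by
  have : convexHull ℝ (pt '' M) ⊆ {x | φ x = μ} := by
    apply convexHull_min
    · rintro _ ⟨k, hk, rfl⟩; exact hM k hk
    · exact convex_hyperplane φ.toLinearMap.isLinear μ
  exact this hx

lemma mem_convexHull_image_of_eq {φ : E →L[ℝ] ℝ} {μ : ℝ} {M : Set ι}
    (hle : ∀ k, φ (pt k) ≤ μ) (hM : ∀ k, φ (pt k) = μ → k ∈ M) {x : E}
    (hx : x ∈ convexHull ℝ (Set.range pt)) (hφ : φ x = μ) : x ∈ convexHull ℝ (pt '' M) := by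
  have : convexHull ℝ (Set.range pt) ⊆ {x | φ x ≤ μ ∧ (φ x = μ → x ∈ convexHull ℝ (pt '' M))} := by
    apply convexHull_min
    · rintro _ ⟨k, rfl⟩
      exact ⟨hle k, fun h => subset_convexHull ℝ _ ⟨k, hM k h, rfl⟩⟩
    · rw [convex_iff_forall_pos]
      rintro x ⟨hx, hx'⟩ y ⟨hy, hy'⟩ a b ha hb hab
      obtain rfl : b = 1 - a := by linarith
      have e : φ (a • x + (1 - a) • y) = a * φ x + (1 - a) * φ y := by simp
      refine ⟨?_, fun h => ?_⟩
      · rw [e]; nlinarith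
      · rw [e] at h
        have h1 : φ x = μ := le_antisymm hx (by nlinarith)
        have h2 : φ y = μ := le_antisymm hy (by nlinarith)
        exact (convex_convexHull ℝ _) (hx' h1) (hy' h2) ha.le hb.le hab
  exact (this hx).2 hφ

/-- The points of a family on which a functional attains its maximum `μ` over the family span the
face of the convex hull exposed by this functional. -/
lemma isExposed_convexHull_image {φ : E →L[ℝ] ℝ} {μ : ℝ} {M : Set ι}
    (hle : ∀ k, φ (pt k) ≤ μ) (hM : ∀ k, φ (pt k) = μ ↔ k ∈ M) :
    IsExposed ℝ (convexHull ℝ (Set.range pt)) (convexHull ℝ (pt '' M)) := by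
  intro hne
  obtain ⟨k, hk⟩ : M.Nonempty := by
    simpa using hne
  refine ⟨φ, ?_⟩
  ext x
  constructor
  · intro hx
    refine ⟨convexHull_mono (Set.image_subset_range _ _) hx, fun y hy => ?_⟩
    rw [eq_of_mem_convexHull_image (fun k hk => (hM k).2 hk) hx]
    exact le_of_mem_convexHull_range hle hy
  · rintro ⟨hx, hy⟩
    refine mem_convexHull_image_of_eq hle (fun k => (hM k).1) hx ?_
    apply le_antisymm (le_of_mem_convexHull_range hle hx)
    rw [← (hM k).2 hk]
    exact hy _ (subset_convexHull ℝ _ ⟨k, rfl⟩)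

/-- Conversely to `isExposed_convexHull_image`, a nonempty exposed face is the convex hull of the
points of the family that maximize some functional. -/
lemma exists_functional_of_isExposed {F : Set E}
    (hF : IsExposed ℝ (convexHull ℝ (Set.range pt)) F) (hne : F.Nonempty) :
    ∃ (φ : E →L[ℝ] ℝ) (μ : ℝ), (∀ k, φ (pt k) ≤ μ) ∧ {k | φ (pt k) = μ}.Nonempty ∧
      F = convexHull ℝ (pt '' {k | φ (pt k) = μ}) := by
  obtain ⟨φ, hφ⟩ := hF hne
  obtain ⟨x₀, hx₀⟩ := hne
  have hx₀' := hx₀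
  rw [hφ] at hx₀'
  obtain ⟨hxP, hmax⟩ := hx₀'
  have hle : ∀ k, φ (pt k) ≤ φ x₀ := fun k => hmax _ (subset_convexHull ℝ _ ⟨k, rfl⟩)
  have hmem := mem_convexHull_image_of_eq (M := {k | φ (pt k) = φ x₀}) hle (fun k h => h) hxP rfl
  refine ⟨φ, φ x₀, hle, ?_, ?_⟩
  · have : (convexHull ℝ (pt '' {k | φ (pt k) = φ x₀})).Nonempty := ⟨_, hmem⟩
    simpa using this
  · ext x
    rw [hφ]
    constructor
    · rintro ⟨hx, hy⟩
      exact mem_convexHull_image_of_eq hle (fun k h => h) hx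
        (le_antisymm (hmax _ hx) (hy _ hxP))
    · intro hx
      refine ⟨convexHull_mono (Set.image_subset_range _ _) hx, fun y hy => ?_⟩
      rw [eq_of_mem_convexHull_image (M := {k | φ (pt k) = φ x₀}) (fun k hk => hk) hx]
      exact hmax y hy

lemma vectorSpan_convexHull (s : Set E) : vectorSpan ℝ (convexHull ℝ s) = vectorSpan ℝ s := by
  rw [← direction_affineSpan, affineSpan_convexHull, direction_affineSpan]

lemma dim_convexHull_image [Finite ι] {M : Set ι}
    (hM : AffineIndependent ℝ (fun k : M => pt k)) (hne : M.Nonempty) :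
    dim (convexHull ℝ (pt '' M)) + 1 = M.ncard := by
  have := Fintype.ofFinite ι
  classical
  have hpos : 0 < M.ncard := (Set.ncard_pos).2 hne
  have hc : Fintype.card M = (M.ncard - 1) + 1 := by
    rw [← Nat.card_eq_fintype_card, Nat.card_coe_set_eq]; omega
  have := hM.finrank_vectorSpan hc
  rw [Set.image_eq_range, dim, vectorSpan_convexHull, this]
  omega

lemma dim_mono [FiniteDimensional ℝ E] {s t : Set E} (h : s ⊆ t) : dim s ≤ dim t :=
  Submodule.finrank_mono (vectorSpan_mono ℝ h)

lemma vectorSpan_le_ker {φ : E →L[ℝ] ℝ} {μ : ℝ} {s : Set E} (h : ∀ x ∈ s, φ x = μ) :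
    vectorSpan ℝ s ≤ φ.toLinearMap.ker := by
  rw [vectorSpan_def, Submodule.span_le]
  rintro _ ⟨x, hx, y, hy, rfl⟩
  simp [h x hx, h y hy]

lemma dim_lt_of_functional [FiniteDimensional ℝ E] {φ : E →L[ℝ] ℝ} {μ : ℝ} {s : Set E}
    (h : ∀ x ∈ s, φ x = μ) (hφ : φ ≠ 0) : dim s < Module.finrank ℝ E := by
  refine lt_of_le_of_lt (Submodule.finrank_mono (vectorSpan_le_ker h)) ?_
  apply Submodule.finrank_lt
  intro h'
  apply hφ
  ext x
  have : x ∈ φ.toLinearMap.ker := by rw [h']; trivial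
  simpa using this

/-- A functional that is constant on a set is constant on every larger set of the same
dimension. -/
lemma eq_of_dim_le [FiniteDimensional ℝ E] {s t : Set E} (hst : s ⊆ t)
    (hs : s.Nonempty) (hdim : dim t ≤ dim s) {φ : E →L[ℝ] ℝ} {μ : ℝ} (h : ∀ x ∈ s, φ x = μ) :
    ∀ x ∈ t, φ x = μ := by
  have e : vectorSpan ℝ s = vectorSpan ℝ t :=
    Submodule.eq_of_le_of_finrank_le (vectorSpan_mono ℝ hst) hdim
  obtain ⟨y, hy⟩ := hs
  intro x hx
  have h1 : x -ᵥ y ∈ vectorSpan ℝ s := by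
    rw [e]; exact vsub_mem_vectorSpan ℝ hx (hst hy)
  have h2 := vectorSpan_le_ker h h1
  have h3 : φ x - φ y = 0 := by simpa using h2
  rw [h y hy] at h3
  linarith

lemma isSimplex_convexHull_image [Finite ι] {M : Set ι}
    (hM : AffineIndependent ℝ (fun k : M => pt k)) (hne : M.Nonempty) :
    IsSimplex (convexHull ℝ (pt '' M)) := by
  have := Fintype.ofFinite ι
  classical
  have hpos : 0 < M.ncard := (Set.ncard_pos).2 hne
  have hc : Fintype.card M = (M.ncard - 1) + 1 := by
    rw [← Nat.card_eq_fintype_card, Nat.card_coe_set_eq]; omega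
  let e := (Fintype.equivFinOfCardEq hc).symm
  refine ⟨M.ncard - 1, ⟨fun i => pt (e i), hM.comp_embedding e.toEmbedding⟩, ?_⟩
  congr 1
  rw [Set.image_eq_range]
  exact (e.surjective.range_comp (fun k : M => pt k)).symm

/-- The extreme points of a simplex are its vertices, so points that are extreme in the whole
polytope and lie in a simplex are affinely independent. -/
lemma affineIndependent_of_isSimplex {M : Set ι} (hinj : Function.Injective pt)
    (hext : ∀ k, pt k ∈ (convexHull ℝ (Set.range pt)).extremePoints ℝ)
    (hS : IsSimplex (convexHull ℝ (pt '' M))) : AffineIndependent ℝ (fun k : M => pt k) := by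
  obtain ⟨m, s, hs⟩ := hS
  have hsub : ∀ k : M, pt k ∈ Set.range s.points := by
    intro k
    apply extremePoints_convexHull_subset (𝕜 := ℝ)
    rw [← hs]
    exact inter_extremePoints_subset_extremePoints_of_subset
      (convexHull_mono (Set.image_subset_range _ _))
      ⟨subset_convexHull ℝ _ ⟨k, k.2, rfl⟩, hext k⟩
  have h1 := s.independent.range
  let f : M ↪ Set.range s.points :=
    ⟨fun k => ⟨pt k, hsub k⟩, fun a b hab => Subtype.ext (hinj (by simpa using hab))⟩
  exact h1.comp_embedding f

end Faces

/-! ### Capped cross-polytopes -/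

/-- Labels of the `3n` vertices of a capped cross-polytope: the two ends of each of the `n`
diagonals of the cross-polytope, and the `n` apices. -/
abbrev Vert (n : ℕ) := Fin n ⊕ Fin n ⊕ Fin n

/-- The positive end of the `i`-th diagonal. -/
abbrev pos {n : ℕ} (i : Fin n) : Vert n := Sum.inl i

/-- The negative end of the `i`-th diagonal. -/
abbrev neg {n : ℕ} (i : Fin n) : Vert n := Sum.inr (Sum.inl i)

/-- The `j`-th apex. -/
abbrev apex {n : ℕ} (j : Fin n) : Vert n := Sum.inr (Sum.inr j)

/-- A capped cross-polytope in an `(n + 1)`-dimensional space. In the coordinates given by the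
origin `z` and the basis `b`, the cross-polytope has the vertices `eᵢ` and `-c eᵢ` (`i < n`) in the
horizontal hyperplane, and the `j`-th apex is at height `h j` above `-(h j * r j) (e₁ + ⋯ + eₙ)`.
The last field says that, in the plane of the apices, the line through two consecutive apices
`j` and `j + 1` meets the horizontal axis at the point common to the affine hulls of the
cross-polytope facets with exactly `j + 1` negative vertices. -/
structure Cap (n : ℕ) (E : Type*) [NormedAddCommGroup E] [NormedSpace ℝ E] where
  z : E
  b : Module.Basis (Option (Fin n)) ℝ E
  c : ℝ
  h : ℕ → ℝ
  r : ℕ → ℝ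
  c_pos : 0 < c
  h_pos : ∀ j, j < n → 0 < h j
  r_lt_succ : ∀ j, j + 1 < n → r j < r (j + 1)
  inv_h_sub : ∀ j, j + 1 < n →
    1 / h (j + 1) - 1 / h j = (r (j + 1) - r j) * ((j + 1) * (1 + 1 / c) - n)

namespace Cap

variable {n : ℕ} {E : Type*} [NormedAddCommGroup E] [NormedSpace ℝ E] (D : Cap n E)

/-- The vertices of a capped cross-polytope. -/
noncomputable def pt : Vert n → E
  | .inl i => D.z + D.b (some i)
  | .inr (.inl i) => D.z - D.c • D.b (some i)
  | .inr (.inr j) => D.z + D.h j • (D.b none - D.r j • ∑ i, D.b (some i))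

/-- Incidence of vertices and facets. The facet `none` is the cross-polytope itself; the facet
`some I` contains the cross-polytope facet with the negative vertices `I`, and the apices numbered
`|I| - 1` and `|I|`, as far as they exist. -/
def Inc : Option (Finset (Fin n)) → Vert n → Prop
  | none, .inl _ => True
  | none, .inr (.inl _) => True
  | none, .inr (.inr _) => False
  | some I, .inl i => i ∉ I
  | some I, .inr (.inl i) => i ∈ I
  | some I, .inr (.inr j) => (j : ℕ) = I.card ∨ (j : ℕ) + 1 = I.card

@[simp] lemma inc_none_pos (i : Fin n) : Inc none (pos i) := trivial
@[simp] lemma inc_none_neg (i : Fin n) : Inc none (neg i) := trivial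
@[simp] lemma inc_none_apex (i : Fin n) : ¬ Inc none (apex i) := id
@[simp] lemma inc_some_pos (I : Finset (Fin n)) (i : Fin n) : Inc (some I) (pos i) ↔ i ∉ I :=
  Iff.rfl
@[simp] lemma inc_some_neg (I : Finset (Fin n)) (i : Fin n) : Inc (some I) (neg i) ↔ i ∈ I :=
  Iff.rfl
@[simp] lemma inc_some_apex (I : Finset (Fin n)) (j : Fin n) :
    Inc (some I) (apex j) ↔ (j : ℕ) = I.card ∨ (j : ℕ) + 1 = I.card := Iff.rfl

lemma map_pos (φ : E →ₗ[ℝ] ℝ) (i : Fin n) : φ (D.pt (pos i)) = φ D.z + φ (D.b (some i)) := by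
  simp [pt]

lemma map_neg (φ : E →ₗ[ℝ] ℝ) (i : Fin n) :
    φ (D.pt (neg i)) = φ D.z - D.c * φ (D.b (some i)) := by
  simp [pt]

lemma map_apex (φ : E →ₗ[ℝ] ℝ) (j : Fin n) :
    φ (D.pt (apex j)) = φ D.z + D.h j * (φ (D.b none) - D.r j * ∑ i, φ (D.b (some i))) := by
  simp [pt]

/-! ### The chain of apices -/

lemma r_lt {i j : ℕ} (hij : i < j) (hj : j < n) : D.r i < D.r j := by
  induction j, hij using Nat.le_induction with
  | base => exact D.r_lt_succ i hj
  | succ k hk ih => exact (ih (by omega)).trans (D.r_lt_succ k hj)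

lemma r_inj {i j : ℕ} (hi : i < n) (hj : j < n) (h : D.r i = D.r j) : i = j := by
  rcases lt_trichotomy i j with h' | h' | h'
  · exact absurd h (D.r_lt h' hj).ne
  · exact h'
  · exact absurd h (D.r_lt h' hi).ne'

/-- The largest value `y` such that the functional with `y` on the vertical basis vector and with
sum `n - k (1 + 1 / c)` on the horizontal ones is at most `1` at the `j`-th apex. -/
noncomputable def bound (k : ℝ) (j : ℕ) : ℝ := 1 / D.h j - D.r j * (k * (1 + 1 / D.c) - n)

lemma kappa_pos : 0 < 1 + 1 / D.c := by have := D.c_pos; positivity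

lemma bound_succ_sub (k : ℝ) {j : ℕ} (hj : j + 1 < n) :
    D.bound k (j + 1) - D.bound k j =
      (D.r (j + 1) - D.r j) * (1 + 1 / D.c) * (j + 1 - k) := by
  have := D.inv_h_sub j hj
  simp only [bound]
  linear_combination this

lemma bound_lt_of_le {k : ℕ} {i j : ℕ} (hk : k ≤ i) (hij : i < j) (hj : j < n) :
    D.bound k i < D.bound k j := by
  have key : ∀ i : ℕ, k ≤ i → i + 1 < n → D.bound k i < D.bound k (i + 1) := by
    intro i hk hi
    have h1 := D.bound_succ_sub k hi
    have h2 : (k : ℝ) ≤ i := by exact_mod_cast hk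
    have := mul_pos (mul_pos (sub_pos.2 (D.r_lt_succ i hi)) D.kappa_pos)
      (show (0 : ℝ) < i + 1 - k by linarith)
    linarith
  induction j, hij using Nat.le_induction with
  | base => exact key i hk hj
  | succ m hm ih => exact (ih (by omega)).trans (key m (by omega) hj)

lemma bound_lt_of_lt {k : ℕ} {i j : ℕ} (hij : i < j) (hk : j + 1 ≤ k) (hj : j < n) :
    D.bound k j < D.bound k i := by
  have key : ∀ i : ℕ, i + 2 ≤ k → i + 1 < n → D.bound k (i + 1) < D.bound k i := by
    intro i hk hi
    have h1 := D.bound_succ_sub k hi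
    have h2 : (i : ℝ) + 2 ≤ k := by exact_mod_cast hk
    have := mul_pos (mul_pos (sub_pos.2 (D.r_lt_succ i hi)) D.kappa_pos)
      (show (0 : ℝ) < k - (i + 1) by linarith)
    linarith
  induction j, hij using Nat.le_induction with
  | base => exact key i hk hj
  | succ m hm ih => exact (key m hk hj).trans (ih (by omega) (by omega))

lemma bound_eq {k : ℕ} (hk : k + 1 < n) : D.bound (k + 1 : ℕ) (k + 1) = D.bound (k + 1 : ℕ) k := by
  have := D.bound_succ_sub (k + 1 : ℕ) hk
  push_cast at this ⊢
  linarith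

/-- On the vertical line of functionals that belongs to `k`, the tightest constraints come from
the apices `k - 1` and `k` exactly. -/
lemma exists_min_bound {k : ℕ} (hk : k ≤ n) :
    ∃ m : ℝ, ∀ j, j < n → m ≤ D.bound k j ∧ (m = D.bound k j ↔ j = k ∨ j + 1 = k) := by
  rcases Nat.eq_zero_or_pos k with rfl | hpos
  · refine ⟨D.bound (0 : ℕ) 0, fun j hj => ?_⟩
    rcases Nat.eq_zero_or_pos j with rfl | hj0
    · simp
    · have := D.bound_lt_of_le (k := 0) (i := 0) le_rfl hj0 hj
      exact ⟨this.le, fun h => absurd h this.ne, fun h => by omega⟩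
  · obtain ⟨k, rfl⟩ : ∃ m, k = m + 1 := ⟨k - 1, by omega⟩
    refine ⟨D.bound (k + 1 : ℕ) k, fun j hj => ?_⟩
    rcases lt_trichotomy j k with h | h | h
    · have := D.bound_lt_of_lt (k := k + 1) h le_rfl (by omega)
      exact ⟨this.le, fun h => absurd h this.ne, fun h => by omega⟩
    · subst h; simp
    · rcases Nat.eq_or_lt_of_le h with h' | h'
      · obtain rfl : j = k + 1 := h'.symm
        rw [D.bound_eq hj]
        simp
      · have h1 := D.bound_lt_of_le (k := k + 1) le_rfl h' hj
        rw [D.bound_eq (by omega)] at h1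
        exact ⟨h1.le, fun h => absurd h h1.ne, fun h => by omega⟩

/-! ### The functionals of the facets -/

lemma finiteDimensional (D : Cap n E) : FiniteDimensional ℝ E :=
  D.b.finiteDimensional_of_finite

lemma finrank_eq (D : Cap n E) : Module.finrank ℝ E = n + 1 := by
  rw [Module.finrank_eq_card_basis D.b]; simp

lemma exists_functional (x : Fin n → ℝ) (y : ℝ) :
    ∃ φ : E →L[ℝ] ℝ, (∀ i, φ (D.b (some i)) = x i) ∧ φ (D.b none) = y := by
  have := D.finiteDimensional
  refine ⟨LinearMap.toContinuousLinearMap (D.b.constr ℝ (fun o => o.elim y x)), fun i => ?_, ?_⟩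
  · simp
  · simp

lemma sum_ite_neg (I : Finset (Fin n)) (a : ℝ) :
    ∑ i, (if i ∈ I then -a else 1 : ℝ) = n - I.card * (1 + a) := by
  have : ∀ i, (if i ∈ I then -a else 1 : ℝ) = 1 - (if i ∈ I then 1 + a else 0) := by
    intro i; split_ifs <;> ring
  simp only [this, Finset.sum_sub_distrib]
  simp
  ring

/-- Each label of a facet comes with a functional which is maximal precisely at the vertices
incident with it. -/
lemma exists_facet_functional (hn : 0 < n) (J : Option (Finset (Fin n))) :
    ∃ (φ : E →L[ℝ] ℝ) (μ : ℝ), φ ≠ 0 ∧ (∀ k, φ (D.pt k) ≤ μ) ∧ ∀ k, φ (D.pt k) = μ ↔ Inc J k := by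
  have hc := D.c_pos
  rcases J with _ | I
  · obtain ⟨φ, hx, hy⟩ := D.exists_functional (fun _ => 0) (-1)
    have e1 := D.map_pos φ.toLinearMap
    have e2 := D.map_neg φ.toLinearMap
    have e3 := D.map_apex φ.toLinearMap
    simp only [ContinuousLinearMap.coe_coe, hx, hy] at e1 e2 e3
    refine ⟨φ, φ D.z, fun h => by simp [h] at hy, ?_, ?_⟩
    · rintro (i | i | j)
      · simp [e1]
      · simp [e2]
      · have := D.h_pos j j.2
        simp [e3, this.le]
    · rintro (i | i | j)
      · simp [e1]
      · simp [e2]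
      · have := D.h_pos j j.2
        simp [e3, this.ne']
  · obtain ⟨m, hm⟩ := D.exists_min_bound (k := I.card) (by simpa using I.card_le_univ)
    obtain ⟨φ, hx, hy⟩ := D.exists_functional (fun i => if i ∈ I then - (1 / D.c) else 1) m
    have e1 := D.map_pos φ.toLinearMap
    have e2 := D.map_neg φ.toLinearMap
    have e3 := D.map_apex φ.toLinearMap
    simp only [ContinuousLinearMap.coe_coe, hx, hy, sum_ite_neg] at e1 e2 e3
    have e3' : ∀ j : Fin n, φ (D.pt (apex j)) =
        φ D.z + 1 + D.h j * (m - D.bound I.card j) := by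
      intro j
      have := (D.h_pos j j.2).ne'
      rw [e3, bound]
      field_simp
      ring
    have hc' : 0 < 1 / D.c := by positivity
    refine ⟨φ, φ D.z + 1, ?_, ?_, ?_⟩
    · intro h
      have := hx ⟨0, hn⟩
      rw [h] at this
      have h0 : (0 : E →L[ℝ] ℝ) (D.b (some ⟨0, hn⟩)) = 0 := rfl
      rw [h0] at this
      split_ifs at this <;> linarith
    · rintro (i | i | j)
      · rw [e1]; split_ifs <;> linarith
      · rw [e2]; split_ifs
        · field_simp; linarith
        · linarith
      · rw [e3']
        have := mul_nonneg (D.h_pos j j.2).le (sub_nonneg.2 (hm j j.2).1)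
        linarith
    · rintro (i | i | j)
      · rw [e1]; simp only [inc_some_pos]
        split_ifs with h
        · simp only [h, not_true, iff_false]; intro h'; linarith
        · simp [h]
      · rw [e2]; simp only [inc_some_neg]
        split_ifs with h
        · simp only [h, iff_true]; field_simp; ring
        · simp only [h, iff_false]; intro h'; linarith
      · rw [e3', inc_some_apex, ← (hm j j.2).2]
        have := (D.h_pos j j.2).ne'
        simp [this, sub_eq_zero]

/-! ### Affine dependences between the vertices -/

lemma affineIndependent_of_forall_weights {M : Set (Vert n)}
    (H : ∀ w : Vert n → ℝ, (∀ k, k ∉ M → w k = 0) → ∑ k, w k = 0 →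
      ∑ k, w k • D.pt k = 0 → ∀ k, w k = 0) :
    AffineIndependent ℝ (fun k : M => D.pt k) := by
  classical
  rw [affineIndependent_iff]
  intro s w hw hs e he
  let f : Vert n → ℝ := fun k => if h : k ∈ M then (if (⟨k, h⟩ : M) ∈ s then w ⟨k, h⟩ else 0) else 0
  have hf : ∀ e : M, f e = if e ∈ s then w e else 0 := by
    intro e; simp [f]
  have hf0 : ∀ k, k ∉ M → f k = 0 := by
    intro k hk; simp [f, hk]
  have hsum : ∀ g : Vert n → E × ℝ, ∑ k, f k • g k = ∑ e ∈ s, w e • g e := by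
    intro g
    rw [← Finset.sum_subset (Finset.subset_univ (s.map (Function.Embedding.subtype _)))]
    · rw [Finset.sum_map]
      refine Finset.sum_congr rfl fun e he => ?_
      have := hf e
      rw [if_pos he] at this
      simp [this]
    · intro k _ hk
      by_cases hkM : k ∈ M
      · have h1 : (⟨k, hkM⟩ : M) ∉ s := by
          intro h
          exact hk (Finset.mem_map.2 ⟨⟨k, hkM⟩, h, rfl⟩)
        have := hf ⟨k, hkM⟩
        rw [if_neg h1] at this
        simp [this]
      · rw [hf0 k hkM, zero_smul]
  have h1 := congrArg Prod.snd (hsum fun k => (D.pt k, 1))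
  have h2 := congrArg Prod.fst (hsum fun k => (D.pt k, 1))
  simp only [Prod.snd_sum, Prod.fst_sum, Prod.smul_mk, smul_eq_mul, mul_one] at h1 h2
  have := H f hf0 (h1.trans hw) (h2.trans hs) e
  rw [hf, if_pos he] at this
  exact this

lemma _root_.CrossPolytopeCap.coord_basis (b : Module.Basis (Option (Fin n)) ℝ E)
    (o o' : Option (Fin n)) : b.coord o (b o') = if o' = o then 1 else 0 := by
  rw [Module.Basis.coord_apply, b.repr_self, Finsupp.single_apply]

/-- The coordinates of an affine dependence between the vertices. -/
lemma weights_relations {w : Vert n → ℝ} (h0 : ∑ k, w k = 0) (h1 : ∑ k, w k • D.pt k = 0) :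
    (∑ j : Fin n, w (apex j) * D.h j = 0) ∧
      ∀ i, w (pos i) - D.c * w (neg i) = ∑ j : Fin n, w (apex j) * D.h j * D.r j := by
  have key : ∀ φ : E →ₗ[ℝ] ℝ,
      ∑ i, (w (pos i) - D.c * w (neg i)) * φ (D.b (some i)) +
        ∑ j : Fin n, w (apex j) * (D.h j * (φ (D.b none) - D.r j * ∑ i, φ (D.b (some i)))) = 0 := by
    intro φ
    have h2 := congrArg φ h1
    simp only [map_add, map_sum, map_smul, map_zero, Fintype.sum_sum_type, D.map_pos, D.map_neg,
      D.map_apex, smul_eq_mul, mul_add, mul_sub, Finset.sum_add_distrib,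
      Finset.sum_sub_distrib, ← Finset.sum_mul] at h2
    simp only [Fintype.sum_sum_type] at h0
    have e : ∑ i, (w (pos i) - D.c * w (neg i)) * φ (D.b (some i)) =
        ∑ i, w (pos i) * φ (D.b (some i)) - ∑ i, w (neg i) * (D.c * φ (D.b (some i))) := by
      rw [← Finset.sum_sub_distrib]
      exact Finset.sum_congr rfl fun i _ => by ring
    rw [e]
    simp only [mul_sub, Finset.sum_sub_distrib]
    linear_combination h2 - φ D.z * h0
  constructor
  · have := key (D.b.coord none)
    simpa [coord_basis, -Module.Basis.coord_apply] using this
  · intro i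
    have := key (D.b.coord (some i))
    simp only [coord_basis, reduceCtorEq, if_false, Option.some.injEq, mul_ite, mul_one, mul_zero,
      Finset.sum_ite_eq', Finset.mem_univ, if_true] at this
    have e : ∑ j : Fin n, w (apex j) * (D.h j * (0 - D.r j)) =
        - ∑ j : Fin n, w (apex j) * D.h j * D.r j := by
      rw [← Finset.sum_neg_distrib]
      exact Finset.sum_congr rfl fun i _ => by ring
    rw [e] at this
    linarith

/-- The vertices of a facet `some I` form a circuit or an affinely independent set: after
leaving out a vertex of the cross-polytope, or all apices but one, they are affinely
independent. -/
lemma affineIndependent_of_inc_some {M : Set (Vert n)} {I : Finset (Fin n)}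
    (hM : ∀ k ∈ M, Inc (some I) k)
    (h : (∃ i, pos i ∉ M ∧ neg i ∉ M) ∨ ∃ j₀ : Fin n, ∀ j, apex j ∈ M → j = j₀) :
    AffineIndependent ℝ (fun k : M => D.pt k) := by
  apply D.affineIndependent_of_forall_weights
  intro w hw h0 h1
  obtain ⟨e1, e2⟩ := D.weights_relations h0 h1
  have hinc : ∀ k, ¬ Inc (some I) k → w k = 0 := fun k hk => hw k fun h => hk (hM k h)
  have hap : ∀ j, w (apex j) = 0 := by
    rcases h with ⟨i, hi, hi'⟩ | ⟨j₀, hj₀⟩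
    · have hT := e2 i
      rw [hw _ hi, hw _ hi', mul_zero, sub_zero] at hT
      intro j
      by_contra hj
      have hjI : Inc (some I) (apex j) := by
        by_contra h; exact hj (hinc _ h)
      have hh := (D.h_pos j j.2).ne'
      -- Besides `j` there is at most one more apex `j'` on the facet.
      by_cases hex : ∃ j' : Fin n, j' ≠ j ∧ Inc (some I) (apex j')
      · obtain ⟨j', hne, hj'⟩ := hex
        have e3 : ∑ l : Fin n, w (apex l) * D.h l * (D.r l - D.r j') = 0 := by
          simp only [mul_sub, Finset.sum_sub_distrib, ← Finset.sum_mul]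
          rw [e1, ← hT]; ring
        rw [Finset.sum_eq_single j] at e3
        · have hr : D.r j - D.r j' ≠ 0 := by
            intro h
            exact hne (Fin.ext (D.r_inj j'.2 j.2 (by linarith)))
          simp [hj, hh, hr] at e3
        · intro l _ hl
          by_cases hll : l = j'
          · simp [hll]
          · rw [hinc (apex l), zero_mul, zero_mul]
            rw [inc_some_apex] at *
            rw [Ne, Fin.ext_iff] at *
            omega
        · simp
      · rw [Finset.sum_eq_single j] at e1
        · simp [hj, hh] at e1
        · intro l _ hl
          rw [hinc (apex l), zero_mul]
          exact fun h => hex ⟨l, hl, h⟩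
        · simp
    · have h3 : ∀ j, j ≠ j₀ → w (apex j) = 0 := fun j hj => hw _ fun h => hj (hj₀ j h)
      intro j
      by_cases hj : j = j₀
      · subst hj
        rw [Finset.sum_eq_single j (fun l _ hl => by rw [h3 l hl, zero_mul]) (by simp)] at e1
        simpa [(D.h_pos j j.2).ne'] using e1
      · exact h3 j hj
  simp only [hap, zero_mul, Finset.sum_const_zero] at e2
  rintro (i | i | j)
  · have := e2 i
    by_cases hi : i ∈ I
    · exact hinc _ (by simpa using hi)
    · rw [hinc (neg i) (by simpa using hi)] at this
      simpa using this
  · have := e2 i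
    by_cases hi : i ∈ I
    · rw [hinc (pos i) (by simpa using hi)] at this
      simpa [D.c_pos.ne'] using this
    · exact hinc _ (by simpa using hi)
  · exact hap j

lemma affineIndependent_pos_neg (i₀ : Fin n) :
    AffineIndependent ℝ (fun k : (insert (neg i₀) (Set.range pos) : Set (Vert n)) => D.pt k) := by
  apply D.affineIndependent_of_forall_weights
  intro w hw h0 h1
  obtain ⟨e1, e2⟩ := D.weights_relations h0 h1
  have hap : ∀ j, w (apex j) = 0 := fun j => hw _ (by simp)
  have hneg : ∀ i, i ≠ i₀ → w (neg i) = 0 := fun i hi => hw _ (by simpa using hi)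
  simp only [hap, zero_mul, Finset.sum_const_zero] at e2
  have hpos : ∀ i, i ≠ i₀ → w (pos i) = 0 := by
    intro i hi
    have := e2 i
    rw [hneg i hi] at this
    linarith
  simp only [Fintype.sum_sum_type, hap, Finset.sum_const_zero] at h0
  rw [Finset.sum_eq_single i₀ (fun i _ hi => hpos i hi) (by simp),
    Finset.sum_eq_single i₀ (fun i _ hi => hneg i hi) (by simp)] at h0
  have h3 := e2 i₀
  have h4 : (1 + D.c) * w (neg i₀) = 0 := by linarith
  have h5 : w (neg i₀) = 0 := by
    have := D.c_pos
    rcases mul_eq_zero.1 h4 with h | h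
    · linarith
    · exact h
  rw [h5] at h3
  rintro (i | i | j)
  · by_cases hi : i = i₀
    · subst hi; linarith
    · exact hpos i hi
  · by_cases hi : i = i₀
    · subst hi; exact h5
    · exact hneg i hi
  · exact hap j

/-! ### Facets and dimensions -/

/-- The polytope itself. -/
def body : Set E := convexHull ℝ (Set.range D.pt)

/-- The facet with a given label. -/
def facet (J : Option (Finset (Fin n))) : Set E := convexHull ℝ (D.pt '' {k | Inc J k})

lemma facet_subset_body (J : Option (Finset (Fin n))) : D.facet J ⊆ D.body :=
  convexHull_mono (Set.image_subset_range _ _)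

lemma pt_mem_body (k : Vert n) : D.pt k ∈ D.body := subset_convexHull ℝ _ ⟨k, rfl⟩

lemma isExposed_facet (hn : 0 < n) (J : Option (Finset (Fin n))) :
    IsExposed ℝ D.body (D.facet J) := by
  obtain ⟨φ, μ, -, hle, heq⟩ := D.exists_facet_functional hn J
  exact isExposed_convexHull_image hle heq

lemma pt_mem_facet_iff (hn : 0 < n) {J : Option (Finset (Fin n))} {k : Vert n} :
    D.pt k ∈ D.facet J ↔ Inc J k := by
  obtain ⟨φ, μ, -, hle, heq⟩ := D.exists_facet_functional hn J
  refine ⟨fun h => (heq k).1 ?_, fun h => subset_convexHull ℝ _ ⟨k, h, rfl⟩⟩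
  exact eq_of_mem_convexHull_image (fun k hk => (heq k).2 hk) h

lemma facet_nonempty (hn : 0 < n) (J : Option (Finset (Fin n))) : (D.facet J).Nonempty := by
  rcases J with _ | I
  · exact ⟨_, (D.pt_mem_facet_iff hn (k := pos ⟨0, hn⟩)).2 trivial⟩
  · by_cases h : ⟨0, hn⟩ ∈ I
    · exact ⟨_, (D.pt_mem_facet_iff hn (k := neg ⟨0, hn⟩)).2 h⟩
    · exact ⟨_, (D.pt_mem_facet_iff hn (k := pos ⟨0, hn⟩)).2 h⟩

lemma dim_facet (hn : 0 < n) (J : Option (Finset (Fin n))) : dim (D.facet J) = n := by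
  have := D.finiteDimensional
  apply le_antisymm
  · obtain ⟨φ, μ, hφ, hle, heq⟩ := D.exists_facet_functional hn J
    have := dim_lt_of_functional (s := D.facet J) (μ := μ)
      (fun x hx => eq_of_mem_convexHull_image (fun k hk => (heq k).2 hk) hx) hφ
    rw [D.finrank_eq] at this
    omega
  · obtain ⟨f, hf, hfJ, hind⟩ : ∃ f : Option (Fin n) → Vert n, Function.Injective f ∧
        (∀ o, Inc J (f o)) ∧ AffineIndependent ℝ (fun k : Set.range f => D.pt k) := by
      rcases J with _ | I
      · refine ⟨fun o => o.elim (neg ⟨0, hn⟩) pos, ?_, ?_, ?_⟩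
        · rintro (_ | i) (_ | j) h <;> simp_all
        · rintro (_ | i) <;> simp
        · have : Set.range (fun o : Option (Fin n) => (o.elim (neg ⟨0, hn⟩) pos : Vert n)) =
              insert (neg ⟨0, hn⟩) (Set.range pos) := by
            ext k; simp [Option.exists, eq_comm]
          rw [this]
          exact D.affineIndependent_pos_neg _
      · classical
        have hcard : I.card ≤ n := by simpa using I.card_le_univ
        obtain ⟨j₀, hj₀⟩ : ∃ j₀ : Fin n, (j₀ : ℕ) = I.card ∨ (j₀ : ℕ) + 1 = I.card := by
          rcases hcard.eq_or_lt with h | h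
          · exact ⟨⟨n - 1, by omega⟩, Or.inr (by simp only; omega)⟩
          · exact ⟨⟨_, h⟩, Or.inl rfl⟩
        have hinc : ∀ o : Option (Fin n),
            Inc (some I) (o.elim (apex j₀) fun i => if i ∈ I then neg i else pos i) := by
          rintro (_ | i)
          · exact hj₀
          · simp only [Option.elim]; split_ifs with h <;> simpa using h
        refine ⟨fun o => o.elim (apex j₀) fun i => if i ∈ I then neg i else pos i, ?_, hinc, ?_⟩
        · rintro (_ | i) (_ | j) h
          · rfl
          · simp only [Option.elim] at h; split_ifs at h <;> simp at h
          · simp only [Option.elim] at h; split_ifs at h <;> simp at h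
          · simp only [Option.elim] at h; split_ifs at h <;> simp_all
        · apply D.affineIndependent_of_inc_some (I := I)
          · rintro _ ⟨o, rfl⟩; exact hinc o
          · refine Or.inr ⟨j₀, ?_⟩
            rintro j ⟨_ | i, h⟩
            · simpa [eq_comm] using h
            · simp only [Option.elim] at h; split_ifs at h <;> simp at h
    have h1 := dim_convexHull_image hind (Set.range_nonempty f)
    have h2 : (Set.range f).ncard = n + 1 := by
      rw [← Set.image_univ, Set.ncard_image_of_injective _ hf]; simp
    have h3 : dim (convexHull ℝ (D.pt '' Set.range f)) ≤ dim (D.facet J) := by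
      apply dim_mono
      apply convexHull_mono
      apply Set.image_mono
      rintro _ ⟨o, rfl⟩; exact hfJ o
    omega

lemma dim_body (hn : 0 < n) : dim D.body = n + 1 := by
  have := D.finiteDimensional
  apply le_antisymm
  · rw [← D.finrank_eq]; exact Submodule.finrank_le _
  · by_contra! hlt
    obtain ⟨φ, μ, hφ, hle, heq⟩ := D.exists_facet_functional hn none
    have := eq_of_dim_le (D.facet_subset_body none) (D.facet_nonempty hn none)
      (by rw [D.dim_facet hn]; omega)
      (fun x hx => eq_of_mem_convexHull_image (fun k hk => (heq k).2 hk) hx)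
      (D.pt (apex ⟨0, hn⟩)) (D.pt_mem_body _)
    exact (heq _).1 this

/-! ### The vertex sets of faces -/

/-- Either a face contains the whole cross-polytope, or it is described by disjoint sets `A`, `B`
of negative and positive vertices. In the latter case the sum of the horizontal coefficients of
its functional, measured by `t` on a scale on which the functional of the facet `some I` has the
value `|I|`, ties the numbers of the apices on the face to `|A|` and `|B|`. -/
lemma face_structure (hn : 0 < n) {φ : E →L[ℝ] ℝ} {μ : ℝ} (hle : ∀ k, φ (D.pt k) ≤ μ) :
    ((∀ i, φ (D.b (some i)) = 0) ∧ φ D.z = μ) ∨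
      ∃ A B : Finset (Fin n), (∀ i, φ (D.pt (neg i)) = μ ↔ i ∈ A) ∧
        (∀ i, φ (D.pt (pos i)) = μ ↔ i ∈ B) ∧ Disjoint A B ∧
        ∃ t : ℝ, A.card ≤ t ∧ t ≤ n - B.card ∧
          ((∃ i, i ∉ A ∧ i ∉ B) → A.card < t ∧ t < n - B.card) ∧
          ∀ j : Fin n, φ (D.pt (apex j)) = μ → j ≤ t ∧ t ≤ j + 1 := by
  classical
  have hc := D.c_pos
  have e1 := D.map_pos φ.toLinearMap
  have e2 := D.map_neg φ.toLinearMap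
  have e3 := D.map_apex φ.toLinearMap
  simp only [ContinuousLinearMap.coe_coe] at e1 e2 e3
  set x : Fin n → ℝ := fun i => φ (D.b (some i)) with hx
  have hx' : ∀ i, φ (D.b (some i)) = x i := fun i => rfl
  set y : ℝ := φ (D.b none)
  simp only [hx'] at e1 e2 e3
  have l1 : ∀ i, x i ≤ μ - φ D.z := fun i => by have := hle (pos i); rw [e1] at this; linarith
  have l2 : ∀ i, -(D.c * x i) ≤ μ - φ D.z := fun i => by
    have := hle (neg i); rw [e2] at this; linarith
  rcases le_or_gt μ (φ D.z) with hz | hz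
  · left
    have h0 : ∀ i, x i = 0 := by
      intro i
      have h1 := l1 i
      have h2 := l2 i
      have h3 : 0 ≤ x i := by
        by_contra! h
        have := mul_pos_of_neg_of_neg h (neg_neg_of_pos hc)
        linarith
      linarith
    refine ⟨h0, le_antisymm ?_ hz⟩
    have := l1 ⟨0, hn⟩
    rw [h0] at this
    linarith
  right
  set δ := μ - φ D.z with hδ
  have hδ0 : 0 < δ := by rw [hδ]; linarith
  have hμ : μ = φ D.z + δ := by rw [hδ]; ring
  set κ : ℝ := 1 + 1 / D.c with hκ
  have hκ0 : 0 < κ := D.kappa_pos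
  have hδκ : 0 < δ * κ := mul_pos hδ0 hκ0
  have hδc : δ / D.c = δ * κ - δ := by rw [hκ]; ring
  have m1 : ∀ i, φ (D.pt (pos i)) = μ ↔ x i = δ := fun i => by
    rw [e1, hμ]; exact add_right_inj _
  have m2 : ∀ i, φ (D.pt (neg i)) = μ ↔ δ - x i = δ * κ := fun i => by
    rw [e2, hμ, hκ]
    field_simp
    constructor <;> intro h <;> linarith
  have l1' : ∀ i, 0 ≤ δ - x i := fun i => by linarith [l1 i]
  have l2' : ∀ i, δ - x i ≤ δ * κ := fun i => by
    have h1 := l2 i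
    have h2 : -x i ≤ δ / D.c := by rw [le_div_iff₀ hc]; linarith
    linarith
  refine ⟨Finset.univ.filter fun i => φ (D.pt (neg i)) = μ,
    Finset.univ.filter fun i => φ (D.pt (pos i)) = μ, by simp, by simp, ?_,
    (∑ i, (δ - x i)) / (δ * κ), ?_⟩
  · rw [Finset.disjoint_left]
    intro i h1 h2
    simp only [Finset.mem_filter, Finset.mem_univ, true_and, m1, m2] at h1 h2
    rw [h2] at h1
    linarith
  set A := Finset.univ.filter fun i => φ (D.pt (neg i)) = μ with hA
  set B := Finset.univ.filter fun i => φ (D.pt (pos i)) = μ with hB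
  have hAm : ∀ i, i ∈ A ↔ δ - x i = δ * κ := by simp [hA, m2]
  have hBm : ∀ i, i ∈ B ↔ x i = δ := by simp [hB, m1]
  have sA : (A.card : ℝ) * (δ * κ) = ∑ i, if i ∈ A then δ * κ else 0 := by simp
  have sB : ((n : ℝ) - B.card) * (δ * κ) = ∑ i, if i ∈ B then 0 else δ * κ := by
    have : ∀ i, (if i ∈ B then (0 : ℝ) else δ * κ) = δ * κ - if i ∈ B then δ * κ else 0 := by
      intro i; split_ifs <;> ring
    simp only [this, Finset.sum_sub_distrib]
    simp
    ring
  have cA : ∀ i ∈ Finset.univ, (if i ∈ A then δ * κ else 0) ≤ δ - x i := by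
    intro i _
    split_ifs with h
    · exact ((hAm i).1 h).ge
    · exact l1' i
  have cB : ∀ i ∈ Finset.univ, δ - x i ≤ (if i ∈ B then 0 else δ * κ) := by
    intro i _
    split_ifs with h
    · rw [(hBm i).1 h]; simp
    · exact l2' i
  refine ⟨?_, ?_, ?_, ?_⟩
  · rw [le_div_iff₀ hδκ, sA]; exact Finset.sum_le_sum cA
  · rw [div_le_iff₀ hδκ, sB]; exact Finset.sum_le_sum cB
  · rintro ⟨i, hiA, hiB⟩
    rw [lt_div_iff₀ hδκ, sA, div_lt_iff₀ hδκ, sB]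
    refine ⟨Finset.sum_lt_sum cA ⟨i, Finset.mem_univ _, ?_⟩,
      Finset.sum_lt_sum cB ⟨i, Finset.mem_univ _, ?_⟩⟩
    · rw [if_neg hiA]
      refine lt_of_le_of_ne (l1' i) fun h => hiB ((hBm i).2 ?_)
      linarith
    · rw [if_neg hiB]
      exact lt_of_le_of_ne (l2' i) fun h => hiA ((hAm i).2 h)
  · intro j hj
    set X := ∑ i, x i with hX
    have hsum : ∑ i, (δ - x i) = n * δ - X := by
      rw [Finset.sum_sub_distrib]; simp [hX]
    have hap : ∀ l : Fin n, y - D.r l * X ≤ δ * (1 / D.h l) := by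
      intro l
      have h1 := hle (apex l)
      have h2 := D.h_pos l l.2
      rw [e3, hμ] at h1
      rw [mul_one_div, le_div_iff₀ h2]
      linarith
    have hapj : y - D.r j * X = δ * (1 / D.h j) := by
      have h2 := D.h_pos j j.2
      rw [e3, hμ] at hj
      rw [mul_one_div, eq_div_iff h2.ne']
      linarith
    rw [le_div_iff₀ hδκ, div_le_iff₀ hδκ, hsum]
    constructor
    · rcases Nat.eq_zero_or_pos (j : ℕ) with h | h
      · rw [h, ← hsum]
        rw [Nat.cast_zero, zero_mul]
        exact Finset.sum_nonneg fun i _ => l1' i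
      · obtain ⟨l, hl⟩ : ∃ l, (j : ℕ) = l + 1 := ⟨j - 1, by omega⟩
        have hln : l + 1 < n := hl ▸ j.2
        have h1 := hap ⟨l, by omega⟩
        have h2 := D.inv_h_sub l hln
        have h3 := D.r_lt_succ l hln
        rw [hl] at hapj
        rw [hl]
        simp only at h1
        have h4 : (D.r (l + 1) - D.r l) * ((l + 1) * (δ * κ)) ≤
            (D.r (l + 1) - D.r l) * (n * δ - X) := by
          have h5 : δ * (1 / D.h (l + 1)) - δ * (1 / D.h l) =
            δ * ((D.r (l + 1) - D.r l) * ((l + 1) * κ - n)) := by rw [← h2]; ring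
          nlinarith
        push_cast
        exact le_of_mul_le_mul_left h4 (by linarith)
    · rcases (Nat.succ_le_of_lt j.2).eq_or_lt with h | h
      · have h5 : (j : ℝ) + 1 = n := by exact_mod_cast h
        rw [h5, ← hsum]
        have := Finset.sum_le_sum fun i (_ : i ∈ (Finset.univ : Finset (Fin n))) => l2' i
        simpa using this
      · have h1 := hap ⟨j + 1, h⟩
        have h2 := D.inv_h_sub j h
        have h3 := D.r_lt_succ j h
        simp only at h1
        have h4 : (D.r (j + 1) - D.r j) * (n * δ - X) ≤
            (D.r (j + 1) - D.r j) * ((j + 1) * (δ * κ)) := by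
          have h5 : δ * (1 / D.h (j + 1)) - δ * (1 / D.h j) =
            δ * ((D.r (j + 1) - D.r j) * ((j + 1) * κ - n)) := by rw [← h2]; ring
          nlinarith
        exact le_of_mul_le_mul_left h4 (by linarith)

lemma exists_facet_of_functional (hn : 0 < n) {φ : E →L[ℝ] ℝ} {μ : ℝ} (hφ : φ ≠ 0)
    (hle : ∀ k, φ (D.pt k) ≤ μ) : ∃ J, ∀ k, φ (D.pt k) = μ → Inc J k := by
  rcases D.face_structure hn hle with ⟨h0, hz⟩ | ⟨A, B, hA, hB, hAB, t, ht1, ht2, -, hap⟩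
  · have e3 := D.map_apex φ.toLinearMap
    simp only [ContinuousLinearMap.coe_coe, h0, Finset.sum_const_zero, mul_zero, sub_zero, hz]
      at e3
    refine ⟨none, ?_⟩
    rintro (i | i | j) h
    · trivial
    · trivial
    · exfalso
      have hy : φ (D.b none) = 0 := by
        rw [e3] at h
        simpa [(D.h_pos j j.2).ne'] using h
      apply hφ
      have : φ.toLinearMap = 0 := D.b.ext fun o => by
        rcases o with _ | i
        · simpa using hy
        · simpa using h0 i
      ext v
      exact LinearMap.congr_fun this v
  · have ht0 : 0 ≤ t := le_trans (Nat.cast_nonneg _) ht1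
    have hBn : B.card ≤ n := by simpa using B.card_le_univ
    have f1 : A.card ≤ ⌊t⌋₊ := Nat.le_floor ht1
    have f2 : ⌊t⌋₊ ≤ Bᶜ.card := by
      rw [Finset.card_compl, Fintype.card_fin]
      apply Nat.floor_le_of_le
      rw [Nat.cast_sub hBn]
      exact ht2
    obtain ⟨I, hAI, hIB, hcard⟩ :=
      Finset.exists_subsuperset_card_eq (Finset.subset_compl_iff_disjoint_right.2 hAB) f1 f2
    refine ⟨some I, ?_⟩
    rintro (i | i | j) h
    · intro hi
      exact Finset.mem_compl.1 (hIB hi) ((hB i).1 h)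
    · exact hAI ((hA i).1 h)
    · obtain ⟨h1, h2⟩ := hap j h
      have h3 : (j : ℕ) ≤ ⌊t⌋₊ := Nat.le_floor h1
      have h4 : ⌊t⌋₊ ≤ (j : ℕ) + 1 := by
        apply Nat.floor_le_of_le; push_cast; exact h2
      rw [inc_some_apex, hcard]
      omega

/-- Every facet is one of the facets constructed above. -/
lemma isFacet_iff (hn : 0 < n) {G : Set E} : IsFacet D.body G ↔ ∃ J, G = D.facet J := by
  have := D.finiteDimensional
  constructor
  · rintro ⟨k, ⟨hexp, hne, hdim⟩, hk⟩
    rw [D.dim_body hn] at hk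
    obtain ⟨φ, μ, hle, hM, hG⟩ := exists_functional_of_isExposed hexp hne
    have hφ : φ ≠ 0 := by
      rintro rfl
      obtain ⟨k₀, hk₀⟩ := hM
      have : D.body = G := by
        rw [hG]
        have : {k | (0 : E →L[ℝ] ℝ) (D.pt k) = μ} = Set.univ := by
          ext k; simpa using hk₀
        rw [this, Set.image_univ]; rfl
      have h2 := D.dim_body hn
      rw [this] at h2
      omega
    obtain ⟨J, hJ⟩ := D.exists_facet_of_functional hn hφ hle
    have hsub : G ⊆ D.facet J := by
      rw [hG]
      exact convexHull_mono (Set.image_mono hJ)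
    refine ⟨J, hsub.antisymm fun x hx => ?_⟩
    have hx' := eq_of_dim_le hsub hne (by rw [D.dim_facet hn]; omega)
      (fun x hx => eq_of_mem_convexHull_image (pt := D.pt) (M := {k | φ (D.pt k) = μ})
        (fun k hk => hk) (hG ▸ hx)) x hx
    rw [hG]
    exact mem_convexHull_image_of_eq hle (fun k hk => hk) (D.facet_subset_body J hx) hx'
  · rintro ⟨J, rfl⟩
    exact ⟨n, ⟨D.isExposed_facet hn J, D.facet_nonempty hn J, D.dim_facet hn J⟩,
      (D.dim_body hn).symm⟩

lemma facet_injective (hn : 0 < n) : Function.Injective D.facet := by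
  have key : ∀ J J' k, D.facet J = D.facet J' → Inc J k → Inc J' k := by
    intro J J' k h hk
    rw [← D.pt_mem_facet_iff hn] at hk ⊢
    rwa [← h]
  have i₀ : Fin n := ⟨0, hn⟩
  intro J J' h
  rcases J with _ | I <;> rcases J' with _ | I'
  · rfl
  · exact absurd (key _ _ (neg i₀) h trivial) (key _ _ (pos i₀) h trivial)
  · exact absurd (key _ _ (neg i₀) h.symm trivial) (key _ _ (pos i₀) h.symm trivial)
  · congr 1
    ext i
    exact ⟨key _ _ (neg i) h, key _ _ (neg i) h.symm⟩

lemma ncard_facets (hn : 0 < n) (q : Set E → Prop) :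
    {G | IsFacet D.body G ∧ q G}.ncard = {J | q (D.facet J)}.ncard := by
  have : {G | IsFacet D.body G ∧ q G} = D.facet '' {J | q (D.facet J)} := by
    ext G
    simp only [D.isFacet_iff hn, Set.mem_ofPred_eq, Set.mem_image]
    constructor
    · rintro ⟨⟨J, rfl⟩, h⟩; exact ⟨J, h, rfl⟩
    · rintro ⟨J, h, rfl⟩; exact ⟨⟨J, rfl⟩, h⟩
  rw [this, Set.ncard_image_of_injective _ (D.facet_injective hn)]

/-! ### Vertices -/

lemma exists_inc_not_inc (hn : 0 < n) {k k' : Vert n} (hk : k ≠ k') :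
    ∃ J, Inc J k ∧ ¬ Inc J k' := by
  rcases k with i | i | j <;> rcases k' with i' | i' | j'
  · have : i ≠ i' := fun h => hk (by rw [h])
    exact ⟨some {i'}, by simpa using this, by simp⟩
  · exact ⟨some ∅, by simp, by simp⟩
  · exact ⟨none, trivial, id⟩
  · exact ⟨some Finset.univ, by simp, by simp⟩
  · have : i ≠ i' := fun h => hk (by rw [h])
    exact ⟨some {i}, by simp, by simpa using this.symm⟩
  · exact ⟨none, trivial, id⟩
  · obtain ⟨I, h1, -, h2⟩ := Finset.exists_subsuperset_card_eq (Finset.subset_univ {i'})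
      (n := j + 1) (by simp) (by simp)
    exact ⟨some I, by simp [h2], by simpa using h1⟩
  · obtain ⟨I, -, h1, h2⟩ := Finset.exists_subsuperset_card_eq (Finset.empty_subset {i'}ᶜ)
      (n := j) (by simp) (by simp [Finset.card_compl]; omega)
    refine ⟨some I, by simp [h2], fun h => ?_⟩
    simpa using h1 h
  · have hne : (j : ℕ) ≠ j' := fun h => hk (by rw [Fin.ext h])
    by_cases hj : (j' : ℕ) + 1 = j
    · obtain ⟨I, -, -, h2⟩ := Finset.exists_subsuperset_card_eq
        (Finset.empty_subset (Finset.univ : Finset (Fin n))) (n := j + 1) (by simp) (by simp)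
      refine ⟨some I, by simp [h2], ?_⟩
      rw [inc_some_apex, h2]; omega
    · obtain ⟨I, -, -, h2⟩ := Finset.exists_subsuperset_card_eq
        (Finset.empty_subset (Finset.univ : Finset (Fin n))) (n := j) (by simp) (by simp)
      refine ⟨some I, by simp [h2], ?_⟩
      rw [inc_some_apex, h2]; omega

lemma pt_injective (hn : 0 < n) : Function.Injective D.pt := by
  intro k k' h
  by_contra hk
  obtain ⟨J, h1, h2⟩ := exists_inc_not_inc hn hk
  rw [← D.pt_mem_facet_iff hn] at h1 h2
  exact h2 (h ▸ h1)

/-- Each of the `3n` points is a vertex: the sum of the functionals of the facets through it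
exposes it. -/
lemma isVertex_pt (hn : 0 < n) (k : Vert n) : IsVertex D.body (D.pt k) := by
  classical
  choose φ μ _ hle heq using D.exists_facet_functional hn
  let s : Finset (Option (Finset (Fin n))) := Finset.univ.filter fun J => Inc J k
  have hexp : IsExposed ℝ D.body (convexHull ℝ (D.pt '' {k})) := by
    have e : ∀ k', (∑ J ∈ s, φ J) (D.pt k') = ∑ J ∈ s, φ J (D.pt k') := by
      intro k'; simp
    refine isExposed_convexHull_image (φ := ∑ J ∈ s, φ J) (μ := ∑ J ∈ s, μ J) ?_ ?_
    · intro k'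
      rw [e]
      exact Finset.sum_le_sum fun J _ => hle J k'
    · intro k'
      rw [e, Finset.sum_eq_sum_iff_of_le fun J _ => hle J k']
      constructor
      · intro h
        by_contra hk
        obtain ⟨J, h1, h2⟩ := exists_inc_not_inc hn (Ne.symm hk)
        exact h2 ((heq J k').1 (h J (by simp [s, h1])))
      · rintro rfl J hJ
        exact (heq J _).2 (by simpa [s] using hJ)
  rw [Set.image_singleton, convexHull_singleton] at hexp
  exact ⟨hexp, Set.singleton_nonempty _, by simp [dim]⟩

lemma isVertex_iff (hn : 0 < n) {x : E} : IsVertex D.body x ↔ ∃ k, x = D.pt k := by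
  constructor
  · rintro ⟨hexp, hne, -⟩
    obtain ⟨φ, μ, hle, ⟨k, hk⟩, hG⟩ := exists_functional_of_isExposed hexp hne
    have : D.pt k ∈ ({x} : Set E) := by
      rw [hG]; exact subset_convexHull ℝ _ ⟨k, hk, rfl⟩
    exact ⟨k, this.symm⟩
  · rintro ⟨k, rfl⟩
    exact D.isVertex_pt hn k

lemma ncard_vertices (hn : 0 < n) : {x | IsVertex D.body x}.ncard = 3 * n := by
  have : {x | IsVertex D.body x} = D.pt '' Set.univ := by
    ext x; simp [D.isVertex_iff hn, eq_comm]
  rw [this, Set.ncard_image_of_injective _ (D.pt_injective hn), Set.ncard_univ,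
    Nat.card_eq_fintype_card]
  simp
  ring

lemma pt_mem_extremePoints (hn : 0 < n) (k : Vert n) :
    D.pt k ∈ (convexHull ℝ (Set.range D.pt)).extremePoints ℝ :=
  isExtreme_singleton.1 (D.isVertex_pt hn k).1.isExtreme

/-! ### Counting the facets through a face -/

lemma ncard_option_of_none {α : Type*} [Finite α] {P : Option α → Prop} (h : P none) :
    {J | P J}.ncard = {a | P (some a)}.ncard + 1 := by
  have : {J | P J} = insert none (some '' {a | P (some a)}) := by
    ext (_ | a) <;> simp [h]
  rw [this, Set.ncard_insert_of_notMem (by simp) (Set.toFinite _),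
    Set.ncard_image_of_injective _ (Option.some_injective _)]

lemma ncard_option_of_not_none {α : Type*} {P : Option α → Prop} (h : ¬ P none) :
    {J | P J}.ncard = {a | P (some a)}.ncard := by
  have : {J | P J} = some '' {a | P (some a)} := by
    ext (_ | a) <;> simp [h]
  rw [this, Set.ncard_image_of_injective _ (Option.some_injective _)]

lemma card_compl_union {A B : Finset (Fin n)} (hAB : Disjoint A B) :
    (A ∪ B)ᶜ.card + (A.card + B.card) = n := by
  have h1 := Finset.card_compl_add_card (A ∪ B)
  rwa [Finset.card_union_of_disjoint hAB, Fintype.card_fin] at h1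

lemma ncard_between {A B : Finset (Fin n)} (hAB : Disjoint A B) (Q : ℕ → Prop)
    [DecidablePred Q] :
    {I : Finset (Fin n) | A ⊆ I ∧ Disjoint I B ∧ Q I.card}.ncard =
      ((A ∪ B)ᶜ.powerset.filter fun T => Q (A.card + T.card)).card := by
  rw [← Set.ncard_coe_finset]
  symm
  have hd : ∀ T ⊆ (A ∪ B)ᶜ, Disjoint A T ∧ Disjoint B T := by
    intro T hT
    rw [Finset.subset_compl_iff_disjoint_left, Finset.disjoint_union_left] at hT
    exact hT
  refine Set.ncard_congr (fun T _ => A ∪ T) ?_ ?_ ?_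
  · intro T hT
    simp only [Finset.coe_filter, Finset.mem_powerset, Set.mem_ofPred_eq] at hT ⊢
    obtain ⟨h1, h2⟩ := hd T hT.1
    refine ⟨Finset.subset_union_left, Finset.disjoint_union_left.2 ⟨hAB, h2.symm⟩, ?_⟩
    rw [Finset.card_union_of_disjoint h1]
    exact hT.2
  · intro T T' hT hT' h
    simp only [Finset.coe_filter, Finset.mem_powerset, Set.mem_ofPred_eq] at hT hT'
    have h1 := (hd T hT.1).1
    have h1' := (hd T' hT'.1).1
    rw [← Finset.union_sdiff_cancel_left h1, ← Finset.union_sdiff_cancel_left h1', h]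
  · rintro I ⟨h1, h2, h3⟩
    refine ⟨I \ A, ?_, Finset.union_sdiff_of_subset h1⟩
    simp only [Finset.coe_filter, Finset.mem_powerset, Set.mem_ofPred_eq]
    constructor
    · intro i hi
      rw [Finset.mem_sdiff] at hi
      rw [Finset.mem_compl, Finset.mem_union]
      rintro (h | h)
      · exact hi.2 h
      · exact Finset.disjoint_left.1 h2 hi.1 h
    · rw [Finset.card_sdiff_of_subset h1]
      have := Finset.card_le_card h1
      rwa [Nat.add_sub_cancel' this]

/-- The vertex set with negative vertices `A`, positive vertices `B` and apices `C`. -/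
def verts (A B C : Finset (Fin n)) : Set (Vert n) := ↑(B.disjSum (A.disjSum C))

@[simp] lemma pos_mem_verts {A B C : Finset (Fin n)} {i : Fin n} : pos i ∈ verts A B C ↔ i ∈ B := by
  simp [verts]

@[simp] lemma neg_mem_verts {A B C : Finset (Fin n)} {i : Fin n} : neg i ∈ verts A B C ↔ i ∈ A := by
  simp [verts]

@[simp] lemma apex_mem_verts {A B C : Finset (Fin n)} {j : Fin n} :
    apex j ∈ verts A B C ↔ j ∈ C := by
  simp [verts]

lemma ncard_verts (A B C : Finset (Fin n)) :
    (verts A B C).ncard = A.card + B.card + C.card := by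
  rw [verts, Set.ncard_coe_finset, Finset.card_disjSum, Finset.card_disjSum]
  ring

lemma verts_inc_none {A B C : Finset (Fin n)} :
    (∀ k ∈ verts A B C, Inc none k) ↔ C = ∅ := by
  rw [Finset.eq_empty_iff_forall_notMem]
  constructor
  · intro h j hj
    exact h (apex j) (apex_mem_verts.2 hj)
  · rintro h (i | i | j) hk
    · trivial
    · trivial
    · exact absurd (apex_mem_verts.1 hk) (h j)

lemma verts_inc_some {A B C I : Finset (Fin n)} :
    (∀ k ∈ verts A B C, Inc (some I) k) ↔
      A ⊆ I ∧ Disjoint I B ∧ ∀ j ∈ C, (j : ℕ) = I.card ∨ (j : ℕ) + 1 = I.card := by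
  rw [disjoint_comm, Finset.disjoint_left]
  constructor
  · intro h
    exact ⟨fun i hi => h (neg i) (neg_mem_verts.2 hi), fun i hi => h (pos i) (pos_mem_verts.2 hi),
      fun j hj => h (apex j) (apex_mem_verts.2 hj)⟩
  · rintro ⟨h1, h2, h3⟩ (i | i | j) hk
    · exact h2 (pos_mem_verts.1 hk)
    · exact h1 (neg_mem_verts.1 hk)
    · exact h3 j (apex_mem_verts.1 hk)

lemma ncard_facets_of_no_apex {A B : Finset (Fin n)} (hAB : Disjoint A B) :
    {J | ∀ k ∈ verts A B ∅, Inc J k}.ncard = 2 ^ (A ∪ B)ᶜ.card + 1 := by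
  rw [ncard_option_of_none (verts_inc_none.2 rfl)]
  congr 1
  simp only [verts_inc_some]
  have := ncard_between hAB (fun _ => True)
  rw [Finset.filter_true, Finset.card_powerset] at this
  rw [← this]
  simp

lemma card_powerset_filter (R : Finset (Fin n)) (a m : ℕ) (h : a ≤ m) :
    (R.powerset.filter fun T => m = a + T.card).card = R.card.choose (m - a) := by
  rw [← Finset.card_powersetCard, Finset.powersetCard_eq_filter]
  congr 1
  ext T
  simp only [Finset.mem_filter]
  refine and_congr_right fun _ => ?_
  omega

lemma ncard_facets_of_one_apex {A B : Finset (Fin n)} (hAB : Disjoint A B) {j : Fin n}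
    (hj : A.card ≤ j) :
    {J | ∀ k ∈ verts A B {j}, Inc J k}.ncard =
      ((A ∪ B)ᶜ.card + 1).choose (j + 1 - A.card) := by
  rw [ncard_option_of_not_none (fun h => by simpa using verts_inc_none.1 h)]
  simp only [verts_inc_some, Finset.mem_singleton, forall_eq]
  rw [ncard_between hAB (fun m => (j : ℕ) = m ∨ (j : ℕ) + 1 = m), Finset.filter_or,
    Finset.card_union_of_disjoint, card_powerset_filter _ _ _ hj,
    card_powerset_filter _ _ _ (by omega), Nat.sub_add_comm hj, Nat.choose_succ_succ]
  rw [Finset.disjoint_filter]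
  intro T _ h
  omega

lemma ncard_facets_of_two_apices {A B : Finset (Fin n)} (hAB : Disjoint A B) {j j' : Fin n}
    (hj : A.card ≤ j) (hj' : (j' : ℕ) = j + 1) :
    {J | ∀ k ∈ verts A B {j, j'}, Inc J k}.ncard =
      (A ∪ B)ᶜ.card.choose (j + 1 - A.card) := by
  rw [ncard_option_of_not_none (fun h => by simpa using verts_inc_none.1 h)]
  simp only [verts_inc_some, Finset.mem_insert, Finset.mem_singleton, forall_eq_or_imp, forall_eq]
  rw [← card_powerset_filter _ _ _ (show A.card ≤ j + 1 by omega),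
    ← ncard_between hAB (fun m => (j : ℕ) + 1 = m)]
  congr 1
  ext I
  simp only [Set.mem_ofPred_eq]
  refine and_congr_right fun _ => and_congr_right fun _ => ?_
  omega

lemma lt_choose {N m : ℕ} (hm : 2 ≤ m) (hN : m + 2 ≤ N) : N < N.choose m := by
  induction N, hN using Nat.le_induction with
  | base =>
    rw [Nat.choose_symm_add, Nat.choose_two_right, Nat.lt_div_iff_mul_lt (by norm_num)]
    obtain ⟨m, rfl⟩ : ∃ l, m = l + 2 := ⟨m - 2, by omega⟩
    have : m + 2 + 2 - 1 = m + 3 := by omega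
    rw [this]
    have h : (m + 2 + 2) * 3 ≤ (m + 2 + 2) * (m + 3) := Nat.mul_le_mul_left _ (by omega)
    omega
  | succ N hN ih =>
    obtain ⟨m, rfl⟩ : ∃ l, m = l + 1 := ⟨m - 1, by omega⟩
    rw [Nat.choose_succ_succ']
    have : 0 < N.choose m := Nat.choose_pos (by omega)
    omega

/-! ### Faces of small dimension -/

/-- A face of codimension at least two is a simplex: its vertices lie on a facet `some I`, and it is
too small to contain all vertices of this facet. The bounds on `t` are those of `face_structure`. -/
lemma exists_verts_of_dim_lt (hn : 0 < n) {F : Set E} (hexp : IsExposed ℝ D.body F)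
    (hne : F.Nonempty) (hdim : dim F < n) :
    ∃ A B C : Finset (Fin n), F = convexHull ℝ (D.pt '' verts A B C) ∧ (verts A B C).Nonempty ∧
      AffineIndependent ℝ (fun k : verts A B C => D.pt k) ∧ Disjoint A B ∧
      ∃ t : ℝ, ((∃ i, i ∉ A ∧ i ∉ B) → A.card < t ∧ t < n - B.card) ∧
          ∀ j ∈ C, (j : ℝ) ≤ t ∧ t ≤ j + 1 := by
  classical
  have := D.finiteDimensional
  obtain ⟨φ, μ, hle, hM, hF⟩ := exists_functional_of_isExposed hexp hne
  have hnot : ∀ J, ¬ ∀ k, Inc J k → φ (D.pt k) = μ := by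
    intro J hJ
    have h1 : dim (D.facet J) ≤ dim F := by
      apply dim_mono
      rw [hF]
      exact convexHull_mono (Set.image_mono hJ)
    rw [D.dim_facet hn] at h1
    omega
  rcases D.face_structure hn hle with ⟨h0, hz⟩ | ⟨A, B, hA, hB, hAB, t, -, -, ht, hap⟩
  · exfalso
    have e1 := D.map_pos φ.toLinearMap
    have e2 := D.map_neg φ.toLinearMap
    simp only [ContinuousLinearMap.coe_coe, h0, mul_zero, sub_zero, add_zero, hz] at e1 e2
    apply hnot none
    rintro (i | i | j) h
    · exact e1 i
    · exact e2 i
    · exact h.elim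
  · have hverts : {k | φ (D.pt k) = μ} =
        verts A B (Finset.univ.filter fun j => φ (D.pt (apex j)) = μ) := by
      ext k
      rcases k with i | i | j
      · rw [pos_mem_verts]; exact hB i
      · rw [neg_mem_verts]; exact hA i
      · rw [apex_mem_verts]; simp
    refine ⟨A, B, Finset.univ.filter fun j => φ (D.pt (apex j)) = μ, hverts ▸ hF, hverts ▸ hM, ?_,
      hAB, t, ht, fun j hj => hap j (by simpa using hj)⟩
    rw [← hverts]
    obtain ⟨I, hI⟩ : ∃ I, ∀ k, φ (D.pt k) = μ → Inc (some I) k := by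
      have hφ : φ ≠ 0 := by
        rintro rfl
        obtain ⟨k, hk⟩ := hM
        exact hnot none fun k' _ => hk
      obtain ⟨J, hJ⟩ := D.exists_facet_of_functional hn hφ hle
      rcases J with _ | I
      · refine ⟨A, ?_⟩
        rintro (i | i | j) h
        · exact fun hi => Finset.disjoint_left.1 hAB hi ((hB i).1 h)
        · exact (hA i).1 h
        · exact (hJ _ h).elim
      · exact ⟨I, hJ⟩
    apply D.affineIndependent_of_inc_some hI
    by_contra! hcon
    obtain ⟨h1, h2⟩ := hcon
    apply hnot (some I)
    obtain ⟨j₁, hj₁, -⟩ := h2 ⟨0, hn⟩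
    obtain ⟨j₂, hj₂, hj₁₂⟩ := h2 j₁
    rintro (i | i | j) h
    · by_contra hi
      exact h (hI _ (h1 i hi))
    · by_contra hi
      have h3 : pos i ∈ {k | φ (D.pt k) = μ} := by
        by_contra h3
        exact hi (h1 i h3)
      exact hI _ h3 h
    · have h3 := hI _ hj₁
      have h4 := hI _ hj₂
      rw [inc_some_apex] at h3 h4
      have h : (j : ℕ) = I.card ∨ (j : ℕ) + 1 = I.card := h
      rw [Ne, Fin.ext_iff] at hj₁₂
      have h5 : j = j₁ ∨ j = j₂ := by
        rw [Fin.ext_iff, Fin.ext_iff]; omega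
      rcases h5 with rfl | rfl
      · exact hj₁
      · exact hj₂

lemma isSimplicial (hn : 0 < n) : IsSimplicial (n - 1) D.body := by
  rintro F ⟨hexp, hne, hdim⟩
  obtain ⟨A, B, C, rfl, hne', hind, -⟩ := D.exists_verts_of_dim_lt hn hexp hne (by omega)
  exact isSimplex_convexHull_image hind hne'

lemma convexHull_subset_facet_iff (hn : 0 < n) {M : Set (Vert n)} {J : Option (Finset (Fin n))} :
    convexHull ℝ (D.pt '' M) ⊆ D.facet J ↔ ∀ k ∈ M, Inc J k := by
  constructor
  · intro h k hk
    exact (D.pt_mem_facet_iff hn).1 (h (subset_convexHull ℝ _ ⟨k, hk, rfl⟩))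
  · intro h
    exact convexHull_mono (Set.image_mono h)

/-- A face of codimension three has `n - 1` vertices, hence `1 + |C|` indices are free to be put
into `I` or not, where `C` is the set of its at most two apices. The bounds on `t` exclude the
distributions of `A` and `B` for which the count would not be three. -/
lemma isSimple_two (hn : 0 < n) : IsSimple 2 D.body := by
  classical
  rintro k F hk ⟨hexp, hne, hdim⟩
  rw [D.dim_body hn] at hk
  obtain ⟨A, B, C, rfl, hne', hind, hAB, t, ht, hC⟩ :=
    D.exists_verts_of_dim_lt hn hexp hne (by omega)
  have hcard := dim_convexHull_image hind hne'
  rw [hdim, ncard_verts] at hcard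
  rw [D.ncard_facets hn]
  simp only [D.convexHull_subset_facet_iff hn]
  have hR := card_compl_union hAB
  by_cases hRpos : (A ∪ B)ᶜ.card = 0
  · -- Then `A` and `B` alone would give more vertices than the face has.
    omega
  obtain ⟨i, hi⟩ := Finset.card_pos.1 (Nat.pos_of_ne_zero hRpos)
  rw [Finset.mem_compl, Finset.mem_union, not_or] at hi
  obtain ⟨ht1, ht2⟩ := ht ⟨i, hi⟩
  have hBn : B.card ≤ n := by simpa using B.card_le_univ
  have hCA : ∀ j ∈ C, A.card ≤ j ∧ (j : ℕ) + B.card < n := by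
    intro j hj
    obtain ⟨h1, h2⟩ := hC j hj
    have h3 : (A.card : ℝ) < ((j + 1 : ℕ) : ℝ) := by push_cast; linarith
    have h4 : ((j + B.card : ℕ) : ℝ) < (n : ℝ) := by push_cast; linarith
    have h3' := Nat.cast_lt.1 h3
    have h4' := Nat.cast_lt.1 h4
    omega
  have hcons : ∀ j ∈ C, ∀ j' ∈ C, (j' : ℕ) ≤ j + 1 := by
    intro j hj j' hj'
    have h : ((j' : ℕ) : ℝ) ≤ ((j + 1 : ℕ) : ℝ) := by
      push_cast; linarith [(hC j hj).2, (hC j' hj').1]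
    exact Nat.cast_le.1 h
  rcases C.eq_empty_or_nonempty with rfl | hCne
  · rw [ncard_facets_of_no_apex hAB]
    have : (A ∪ B)ᶜ.card = 1 := by simp at hcard; omega
    rw [this]; norm_num
  · set j := C.min' hCne with hj
    have hjC : j ∈ C := C.min'_mem hCne
    obtain ⟨h1, h2⟩ := hCA j hjC
    by_cases hex : ∃ j' ∈ C, j' ≠ j
    · obtain ⟨j', hj', hne⟩ := hex
      have hmin : ∀ l ∈ C, (j : ℕ) ≤ l := fun l hl => C.min'_le l hl
      have hjj : (j' : ℕ) = j + 1 := by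
        have := hmin j' hj'
        have := hcons j hjC j' hj'
        rw [Ne, Fin.ext_iff] at hne
        omega
      have hCeq : C = {j, j'} := by
        ext l
        simp only [Finset.mem_insert, Finset.mem_singleton]
        constructor
        · intro hl
          have h3 := hmin l hl
          have h4 := hcons j hjC l hl
          rw [Fin.ext_iff, Fin.ext_iff]
          omega
        · rintro (rfl | rfl) <;> assumption
      obtain ⟨h3, h4⟩ := hCA j' hj'
      have hCcard : C.card = 2 := by rw [hCeq]; exact Finset.card_pair hne.symm
      clear_value j
      subst hCeq
      rw [ncard_facets_of_two_apices hAB h1 hjj]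
      have h5 : (A ∪ B)ᶜ.card = 3 := by omega
      have h6 : (j : ℕ) + 1 - A.card = 1 ∨ (j : ℕ) + 1 - A.card = 2 := by omega
      rw [h5]
      rcases h6 with h6 | h6 <;> rw [h6] <;> rfl
    · push Not at hex
      have hCeq : C = {j} := Finset.eq_singleton_iff_unique_mem.2 ⟨hjC, hex⟩
      have hCcard : C.card = 1 := by rw [hCeq]; simp
      clear_value j
      subst hCeq
      rw [ncard_facets_of_one_apex hAB h1]
      have h5 : (A ∪ B)ᶜ.card = 2 := by omega
      have h6 : (j : ℕ) + 1 - A.card = 1 ∨ (j : ℕ) + 1 - A.card = 2 := by omega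
      rw [h5]
      rcases h6 with h6 | h6 <;> rw [h6] <;> rfl

/-! ### Simple vertices and simplex facets -/

lemma isSimpleVertex_pt_iff (hn : 0 < n) {k : Vert n} :
    IsSimpleVertex D.body (D.pt k) ↔ {J | Inc J k}.ncard = n + 1 := by
  rw [IsSimpleVertex, and_iff_right (D.isVertex_pt hn k), D.ncard_facets hn, D.dim_body hn]
  simp only [D.pt_mem_facet_iff hn]

lemma isSimpleVertex_iff (hn : 3 ≤ n) {x : E} :
    IsSimpleVertex D.body x ↔
      x = D.pt (apex ⟨0, by omega⟩) ∨ x = D.pt (apex ⟨n - 1, by omega⟩) := by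
  have hn0 : 0 < n := by omega
  have hpow : n < 2 ^ (n - 1) := by
    obtain ⟨m, rfl⟩ : ∃ m, n = m + 3 := ⟨n - 3, by omega⟩
    have : m < 2 ^ m := Nat.lt_two_pow_self
    have h2 : m + 3 - 1 = m + 2 := rfl
    rw [h2, pow_add]
    omega
  have hend : ∀ A B : Finset (Fin n), Disjoint A B → A.card + B.card = 1 →
      {J | ∀ k ∈ verts A B ∅, Inc J k}.ncard ≠ n + 1 := by
    intro A B hAB hcard
    have hR := card_compl_union hAB
    rw [ncard_facets_of_no_apex hAB, show (A ∪ B)ᶜ.card = n - 1 by omega]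
    omega
  have hsing : ∀ A B C : Finset (Fin n), ∀ k, verts A B C = {k} →
      {J | Inc J k} = {J | ∀ k ∈ verts A B C, Inc J k} := by
    intro A B C k h
    simp [h]
  have hapex : ∀ j : Fin n, {J | Inc J (apex j)}.ncard = (n + 1).choose (j + 1) := by
    intro j
    rw [hsing ∅ ∅ {j} (apex j) (by ext (i | i | l) <;> simp [verts]),
      ncard_facets_of_one_apex (by simp) (by simp)]
    simp
  constructor
  · intro h
    obtain ⟨k, rfl⟩ := (D.isVertex_iff hn0).1 h.1
    rw [D.isSimpleVertex_pt_iff hn0] at h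
    rcases k with i | i | j
    · rw [hsing ∅ {i} ∅ (pos i) (by ext (i | i | l) <;> simp [verts])] at h
      exact absurd h (hend _ _ (by simp) (by simp))
    · rw [hsing {i} ∅ ∅ (neg i) (by ext (i | i | l) <;> simp [verts])] at h
      exact absurd h (hend _ _ (by simp) (by simp))
    · rw [hapex] at h
      by_cases h0 : (j : ℕ) = 0
      · left; congr 2; simp [Fin.ext_iff, h0]
      · by_cases h1 : (j : ℕ) = n - 1
        · right; congr 2; simp [Fin.ext_iff, h1]
        · have := lt_choose (N := n + 1) (m := j + 1) (by omega) (by omega)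
          omega
  · rintro (rfl | rfl)
    · rw [D.isSimpleVertex_pt_iff hn0, hapex]; simp
    · rw [D.isSimpleVertex_pt_iff hn0, hapex]
      have : n - 1 + 1 = n := by omega
      simp only [this]
      simp

lemma isSimplex_facet_iff (hn : 3 ≤ n) {J : Option (Finset (Fin n))} :
    IsSimplex (D.facet J) ↔ J = some ∅ ∨ J = some Finset.univ := by
  classical
  have hn0 : 0 < n := by omega
  constructor
  · intro h
    have hind := affineIndependent_of_isSimplex (D.pt_injective hn0) (D.pt_mem_extremePoints hn0) h
    rcases J with _ | I
    · exfalso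
      have hset : {k | Inc none k} = verts (Finset.univ : Finset (Fin n)) Finset.univ ∅ := by
        ext (i | i | l) <;> simp [verts, Inc]
      have h1 := dim_convexHull_image hind ⟨pos ⟨0, hn0⟩, trivial⟩
      have h2 : dim (D.facet none) = n := D.dim_facet hn0 none
      rw [facet] at h2
      rw [h2, hset, ncard_verts] at h1
      simp at h1
      omega
    · by_contra! hcon
      obtain ⟨hI0, hI1⟩ := hcon
      have hcard0 : 0 < I.card :=
        Finset.card_pos.2 (Finset.nonempty_iff_ne_empty.2 (by simpa using hI0))
      have hcard1 : I.card < n := by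
        have := (Finset.card_lt_iff_ne_univ I).2 (by simpa using hI1)
        simpa using this
      have hset : {k | Inc (some I) k} = verts I Iᶜ {⟨I.card - 1, by omega⟩, ⟨I.card, hcard1⟩} := by
        ext (i | i | l)
        · simp [verts, Inc]
        · simp [verts, Inc]
        · simp only [verts, Inc, Set.mem_ofPred_eq, Finset.mem_coe, Finset.inr_mem_disjSum,
            Finset.mem_insert, Finset.mem_singleton, Fin.ext_iff]
          omega
      have h2 : dim (D.facet (some I)) = n := D.dim_facet hn0 (some I)
      have h3 : (⟨I.card - 1, by omega⟩ : Fin n) ≠ ⟨I.card, hcard1⟩ := by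
        rw [Ne, Fin.ext_iff]; simp only; omega
      have h1 := dim_convexHull_image hind
        ⟨apex ⟨I.card, hcard1⟩, Or.inl rfl⟩
      rw [facet] at h2
      rw [h2, hset, ncard_verts, Finset.card_pair h3, Finset.card_compl, Fintype.card_fin] at h1
      omega
  · rintro (rfl | rfl)
    · refine isSimplex_convexHull_image (D.affineIndependent_of_inc_some (I := ∅)
        (fun k hk => hk) (Or.inr ⟨⟨0, hn0⟩, fun j hj => ?_⟩)) ⟨pos ⟨0, hn0⟩, by simp⟩
      have : (j : ℕ) = (∅ : Finset (Fin n)).card ∨ (j : ℕ) + 1 = (∅ : Finset (Fin n)).card := hj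
      simpa [Fin.ext_iff] using this
    · refine isSimplex_convexHull_image (D.affineIndependent_of_inc_some (I := Finset.univ)
        (fun k hk => hk) (Or.inr ⟨⟨n - 1, by omega⟩, fun j hj => ?_⟩)) ⟨neg ⟨0, hn0⟩, by simp⟩
      have : (j : ℕ) = (Finset.univ : Finset (Fin n)).card ∨
        (j : ℕ) + 1 = (Finset.univ : Finset (Fin n)).card := hj
      rw [Finset.card_univ, Fintype.card_fin] at this
      rw [Fin.ext_iff]
      simp only
      omega

lemma simplex_facet_simple_vertex_pairs (hn : 3 ≤ n) :
    {q : Set E × E | (IsFacet D.body q.1 ∧ IsSimplex q.1) ∧ IsSimpleVertex D.body q.2 ∧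
        q.2 ∉ q.1} =
      {(D.facet (some Finset.univ), D.pt (apex ⟨0, by omega⟩)),
        (D.facet (some ∅), D.pt (apex ⟨n - 1, by omega⟩))} := by
  have hn0 : 0 < n := by omega
  ext ⟨G, x⟩
  simp only [Set.mem_ofPred_eq, Set.mem_insert_iff, Set.mem_singleton_iff, Prod.mk.injEq,
    D.isSimpleVertex_iff hn, D.isFacet_iff hn0]
  constructor
  · rintro ⟨⟨⟨J, rfl⟩, hS⟩, hx, hmem⟩
    rcases (D.isSimplex_facet_iff hn).1 hS with rfl | rfl <;> rcases hx with rfl | rfl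
    · exact absurd ((D.pt_mem_facet_iff hn0).2 (by simp)) hmem
    · exact Or.inr ⟨rfl, rfl⟩
    · exact Or.inl ⟨rfl, rfl⟩
    · exact absurd ((D.pt_mem_facet_iff hn0).2 (by simp; omega)) hmem
  · rintro (⟨rfl, rfl⟩ | ⟨rfl, rfl⟩)
    · refine ⟨⟨⟨_, rfl⟩, (D.isSimplex_facet_iff hn).2 (Or.inr rfl)⟩, Or.inl rfl, ?_⟩
      rw [D.pt_mem_facet_iff hn0]; simp; omega
    · refine ⟨⟨⟨_, rfl⟩, (D.isSimplex_facet_iff hn).2 (Or.inl rfl)⟩, Or.inr rfl, ?_⟩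
      rw [D.pt_mem_facet_iff hn0]; simp; omega

end Cap

/-! ### Cross-polytopes and the points common to their facet hulls -/

section Frame

variable {n : ℕ} {E : Type*} [NormedAddCommGroup E] [NormedSpace ℝ E]

/-- The point of the axis of the cross-polytope with vertices `z + bᵢ` and `z - c bᵢ` that lies on
the affine hulls of all facets with exactly `k` negative vertices. -/
noncomputable def axisPoint (z : E) (b : Module.Basis (Option (Fin n)) ℝ E) (c : ℝ) (k : ℕ) : E :=
  z - (1 / (k * (1 + 1 / c) - n)) • ∑ i, b (some i)

/-- A chain of points, each on the open segment from the corresponding axis point to its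
predecessor, is the chain of apices of a capped cross-polytope. -/
lemma exists_cap (z : E) (b : Module.Basis (Option (Fin n)) ℝ E) {c : ℝ} (hc : 0 < c)
    (hβ : ∀ k : ℕ, 1 ≤ k → 0 < k * (1 + 1 / c) - n) {v : ℕ → E} (hv0 : v 0 = z + b none)
    (hv : ∀ j, j + 1 < n → v (j + 1) ∈ openSegment ℝ (axisPoint z b c (j + 1)) (v j)) :
    ∃ D : Cap n E, D.z = z ∧ D.b = b ∧ D.c = c ∧ ∀ j : Fin n, D.pt (apex j) = v j := by
  have hform : ∀ j, ∃ h T : ℝ, j < n → 0 < h ∧ v j = z + h • b none - T • ∑ i, b (some i) := by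
    intro j
    induction j with
    | zero => exact ⟨1, 0, fun _ => ⟨one_pos, by simp [hv0]⟩⟩
    | succ j ih =>
      obtain ⟨h, T, ih⟩ := ih
      by_cases hj : j + 1 < n
      · obtain ⟨s, t, hs, ht, hst, he⟩ := hv j hj
        obtain ⟨h1, h2⟩ := ih (by omega)
        refine ⟨t * h, s * (1 / ((j + 1 : ℕ) * (1 + 1 / c) - n)) + t * T,
          fun _ => ⟨mul_pos ht h1, ?_⟩⟩
        rw [← he, h2, axisPoint]
        obtain rfl : s = 1 - t := by linarith
        module
      · exact ⟨0, 0, fun h => absurd h hj⟩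
  choose h T hhT using hform
  have hstep : ∀ j, j + 1 < n → ∃ t : ℝ, 0 < t ∧ t < 1 ∧ h (j + 1) = t * h j ∧
      T (j + 1) = (1 - t) * (1 / ((j + 1) * (1 + 1 / c) - n)) + t * T j := by
    intro j hj
    obtain ⟨s, t, hs, ht, hst, he⟩ := hv j hj
    obtain rfl : s = 1 - t := by linarith
    refine ⟨t, ht, by linarith, ?_⟩
    have h1 := (hhT j (by omega)).2
    have h2 := (hhT (j + 1) hj).2
    rw [h1, h2, axisPoint] at he
    have hc1 := congrArg (b.coord none) he
    have hc2 := congrArg (b.coord (some ⟨0, by omega⟩)) he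
    simp only [map_add, map_sub, map_smul, map_sum, coord_basis, smul_eq_mul, reduceCtorEq,
      if_false, if_true, Option.some.injEq, Finset.sum_const_zero, mul_zero, mul_one, sub_zero,
      add_zero, Finset.sum_ite_eq', Finset.mem_univ, Nat.cast_add, Nat.cast_one] at hc1 hc2
    constructor
    · linarith
    · linarith
  refine ⟨⟨z, b, c, h, fun j => T j / h j, hc, fun j hj => (hhT j hj).1, ?_, ?_⟩, rfl, rfl, rfl, ?_⟩
  · intro j hj
    obtain ⟨t, ht, ht1, e1, e2⟩ := hstep j hj
    have hh := (hhT j (by omega)).1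
    have hβj := hβ (j + 1) (by omega)
    push_cast at hβj
    rw [e1, e2, div_lt_div_iff₀ hh (mul_pos ht hh)]
    have : 0 < h j * ((1 - t) * (1 / ((j + 1) * (1 + 1 / c) - n))) :=
      mul_pos hh (mul_pos (by linarith) (by positivity))
    linarith
  · intro j hj
    obtain ⟨t, ht, ht1, e1, e2⟩ := hstep j hj
    have hh := (hhT j (by omega)).1
    have hβj := hβ (j + 1) (by omega)
    push_cast at hβj
    set β : ℝ := (j + 1) * (1 + 1 / c) - n with hβdef
    rw [e1, e2]
    field_simp
    ring
  · intro j
    have hh := (hhT j j.2).1.ne'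
    rw [(hhT j j.2).2]
    simp only [Cap.pt, smul_sub, smul_smul, mul_div_cancel₀ _ hh]
    abel

lemma eq_of_mem_affineSpan {s : Set E} {φ : E →ₗ[ℝ] ℝ} {μ : ℝ} (h : ∀ x ∈ s, φ x = μ) {x : E}
    (hx : x ∈ affineSpan ℝ s) : φ x = μ := by
  refine affineSpan_induction (p := fun x => φ x = μ) hx h fun t u v w hu hv hw => ?_
  simp [hu, hv, hw]

/-- The vertices of the facet of the cross-polytope with negative vertices `I`. -/
noncomputable def crossFacet (z : E) (b : Module.Basis (Option (Fin n)) ℝ E) (c : ℝ)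
    (I : Finset (Fin n)) (i : Fin n) : E :=
  if i ∈ I then z - c • b (some i) else z + b (some i)

lemma axisPoint_mem_affineSpan (z : E) (b : Module.Basis (Option (Fin n)) ℝ E) {c : ℝ}
    (hc : 0 < c) {k : ℕ} (hβ : (k * (1 + 1 / c) - n : ℝ) ≠ 0) {I : Finset (Fin n)}
    (hI : I.card = k) :
    axisPoint z b c k ∈ affineSpan ℝ (Set.range (crossFacet z b c I)) := by
  set β : ℝ := k * (1 + 1 / c) - n with hβdef
  have hsum : ∑ i, (-(1 / β) * if i ∈ I then -(1 / c) else 1) = 1 := by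
    rw [← Finset.mul_sum, Cap.sum_ite_neg, hI]
    have : (n - k * (1 + 1 / c) : ℝ) = -β := by rw [hβdef]; ring
    rw [this]
    field_simp
  have := affineCombination_mem_affineSpan hsum (crossFacet z b c I)
  rw [Finset.affineCombination_eq_linear_combination _ _ _ hsum] at this
  convert this using 1
  have e : ∀ i, (-(1 / β) * if i ∈ I then -(1 / c) else 1) • crossFacet z b c I i =
      (-(1 / β) * if i ∈ I then -(1 / c) else 1) • z - (1 / β) • b (some i) := by
    intro i
    rw [crossFacet]
    split_ifs
    · rw [smul_sub, smul_smul]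
      congr 2
      field_simp
    · rw [smul_add, mul_one, neg_smul, neg_smul]; abel
  rw [Finset.sum_congr rfl fun i _ => e i, Finset.sum_sub_distrib, ← Finset.sum_smul, hsum,
    one_smul, ← Finset.smul_sum]
  rfl

/-- The affine hulls of the facets with `k` negative vertices meet only in the axis point: two
such facets that differ by an exchange of two indices force the corresponding coordinates to
agree. -/
lemma eq_axisPoint (z : E) (b : Module.Basis (Option (Fin n)) ℝ E) {c : ℝ} (hc : 0 < c) {k : ℕ}
    (hk : 1 ≤ k) (hkn : k < n) (hβ : (k * (1 + 1 / c) - n : ℝ) ≠ 0) {x : E}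
    (hx : ∀ I : Finset (Fin n), I.card = k →
      x ∈ affineSpan ℝ (Set.range (crossFacet z b c I))) :
    x = axisPoint z b c k := by
  classical
  have hheight : b.coord none x = b.coord none z := by
    obtain ⟨I, -, -, hI⟩ := Finset.exists_subsuperset_card_eq
      (Finset.empty_subset (Finset.univ : Finset (Fin n))) (n := k) (by simp) (by simp; omega)
    refine eq_of_mem_affineSpan ?_ (hx I hI)
    rintro _ ⟨i, rfl⟩
    rw [crossFacet]
    split_ifs <;> simp [coord_basis, -Module.Basis.coord_apply]
  set s : Fin n → ℝ := fun i => b.coord (some i) x - b.coord (some i) z with hs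
  have hplane : ∀ I : Finset (Fin n), I.card = k →
      ∑ i, (if i ∈ I then -(1 / c) else 1) * s i = 1 := by
    intro I hI
    have := eq_of_mem_affineSpan (φ := ∑ i, (if i ∈ I then -(1 / c) else 1 : ℝ) • b.coord (some i))
      (μ := ∑ i, (if i ∈ I then -(1 / c) else 1 : ℝ) * b.coord (some i) z + 1) ?_ (hx I hI)
    · rw [LinearMap.sum_apply] at this
      simp only [LinearMap.smul_apply, smul_eq_mul] at this
      simp only [hs, mul_sub, Finset.sum_sub_distrib]
      rw [this]; ring
    · rintro _ ⟨l, rfl⟩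
      rw [LinearMap.sum_apply]
      simp only [LinearMap.smul_apply, smul_eq_mul, crossFacet]
      split_ifs with hl
      · simp only [map_sub, map_smul, coord_basis, Option.some.injEq, smul_eq_mul, mul_sub,
          Finset.sum_sub_distrib, mul_ite, mul_one, mul_zero, Finset.sum_ite_eq, Finset.mem_univ,
          if_true, hl]
        field_simp
        ring
      · simp only [map_add, coord_basis, Option.some.injEq, mul_add,
          Finset.sum_add_distrib, mul_ite, mul_one, mul_zero, Finset.sum_ite_eq, Finset.mem_univ,
          if_true, hl, if_false]
  have hsplit : ∀ I : Finset (Fin n), ∑ i, (if i ∈ I then -(1 / c) else 1) * s i =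
      ∑ i, s i - (1 + 1 / c) * ∑ i ∈ I, s i := by
    intro I
    have : ∀ i, (if i ∈ I then -(1 / c) else 1) * s i =
        s i - (1 + 1 / c) * if i ∈ I then s i else 0 := by
      intro i; split_ifs <;> ring
    rw [Finset.sum_congr rfl fun i _ => this i, Finset.sum_sub_distrib, ← Finset.mul_sum]
    simp
  have hκ : (1 + 1 / c : ℝ) ≠ 0 := by positivity
  have hall : ∀ i i', s i = s i' := by
    intro i i'
    by_cases hii : i = i'
    · rw [hii]
    obtain ⟨J, -, hJ, hJc⟩ := Finset.exists_subsuperset_card_eq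
      (Finset.empty_subset ({i, i'}ᶜ : Finset (Fin n))) (n := k - 1) (by simp)
      (by rw [Finset.card_compl, Finset.card_pair hii, Fintype.card_fin]; omega)
    have hi : i ∉ J := fun h => by simpa using hJ h
    have hi' : i' ∉ J := fun h => by simpa using hJ h
    have h1 := hplane (insert i J) (by rw [Finset.card_insert_of_notMem hi]; omega)
    have h2 := hplane (insert i' J) (by rw [Finset.card_insert_of_notMem hi']; omega)
    rw [hsplit, Finset.sum_insert hi] at h1
    rw [hsplit, Finset.sum_insert hi'] at h2
    exact mul_left_cancel₀ hκ (by linarith)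
  have hval : ∀ i, s i = -(1 / (k * (1 + 1 / c) - n)) := by
    intro i
    obtain ⟨I, -, -, hI⟩ := Finset.exists_subsuperset_card_eq
      (Finset.empty_subset (Finset.univ : Finset (Fin n))) (n := k) (by simp) (by simp; omega)
    have h1 := hplane I hI
    rw [hsplit, Finset.sum_congr rfl fun l _ => hall l i,
      Finset.sum_congr (s₁ := I) rfl fun l _ => hall l i] at h1
    simp only [Finset.sum_const, Finset.card_univ, Fintype.card_fin, hI, nsmul_eq_mul] at h1
    rw [eq_neg_iff_add_eq_zero, ← mul_right_inj' hβ, mul_add, mul_one_div_cancel hβ]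
    linarith
  apply b.ext_elem
  intro o
  rw [← Module.Basis.coord_apply, ← Module.Basis.coord_apply, axisPoint, map_sub, map_smul, map_sum]
  rcases o with _ | i
  · simp [coord_basis, hheight, -Module.Basis.coord_apply]
  · have := hval i
    simp only [hs] at this
    simp only [coord_basis, Option.some.injEq, Finset.sum_ite_eq', Finset.mem_univ, if_true,
      smul_eq_mul, mul_one]
    linarith

end Frame

/-! ### Coordinates for the simplex construction -/

section Simplex

variable {n : ℕ}

lemma u'_succ (S : Affine.Simplex ℝ (EuclideanSpace ℝ (Fin (n + 1))) (n + 1)) {j : ℕ}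
    (hj : j < n + 2) : u' S (j + 1) = S.points ⟨j, hj⟩ := by
  simp only [u', Nat.add_sub_cancel]
  congr 1
  ext
  simp [Fin.ofNat, Nat.mod_eq_of_lt hj]

lemma p_succ (S : Affine.Simplex ℝ (EuclideanSpace ℝ (Fin (n + 1))) (n + 1)) (i : Fin n) :
    p S (i + 1) = (1 / n : ℝ) • (∑ l : Fin n, u' S (l + 1) + u' S (n + 1) - u' S (i + 1)) := by
  have hmem : (i : ℕ) + 1 ∈ Finset.Icc 1 (n + 1) := by
    rw [Finset.mem_Icc]; have := i.2; omega
  have hcard : ((Finset.Icc 1 (n + 1)).erase (i + 1)).card = n := by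
    rw [Finset.card_erase_of_mem hmem]; simp
  have hne : ((Finset.Icc 1 (n + 1)).erase ((i : ℕ) + 1)).Nonempty := by
    rw [← Finset.card_pos, hcard]; exact i.pos
  rw [p, Finset.centroid_eq_centerMass _ hne, Finset.centerMass]
  simp only [Finset.centroidWeights_apply, hcard, Finset.sum_const, nsmul_eq_mul]
  have hn : (n : ℝ) ≠ 0 := by exact_mod_cast i.pos.ne'
  have hsum : ∑ l ∈ Finset.Icc 1 (n + 1), u' S l = ∑ l : Fin n, u' S (l + 1) + u' S (n + 1) := by
    rw [Finset.sum_Icc_succ_top (by omega), ← Finset.Ico_add_one_right_eq_Icc,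
      Finset.sum_Ico_eq_sum_range, Fin.sum_univ_eq_sum_range (fun l => u' S (l + 1))]
    simp only [Nat.add_sub_cancel, add_comm 1]
  rw [mul_inv_cancel₀ hn, inv_one, one_smul, ← Finset.smul_sum, one_div, ← hsum,
    ← Finset.add_sum_erase _ _ hmem, add_sub_cancel_left]

/-- The diagonals `[uᵢ, u'ᵢ]` have a common point `z`, and `u'ᵢ - z`, `u'_{d+1} - z` form a
basis, in which all points of the construction have simple coordinates. -/
lemma exists_frame (hn : 0 < n) (S : Affine.Simplex ℝ (EuclideanSpace ℝ (Fin (n + 1))) (n + 1))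
    {ε c : ℝ} (hε : 0 < ε) (hc : c = (1 + ε) / n) :
    ∃ (z : EuclideanSpace ℝ (Fin (n + 1)))
      (b : Module.Basis (Option (Fin n)) ℝ (EuclideanSpace ℝ (Fin (n + 1)))),
      (∀ i : Fin n, u' S (i + 1) = z + b (some i)) ∧
      (∀ i : Fin n, u S ε (i + 1) = z - c • b (some i)) ∧
      u' S (n + 2) = z + b none ∧
      u' S (n + 1) = z - ∑ i, b (some i) + (ε / c) • b none := by
  have hn' : (0 : ℝ) < n := by exact_mod_cast hn
  have hc0 : 0 < c := by rw [hc]; positivity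
  have hnc : n * c = 1 + ε := by rw [hc]; field_simp
  obtain ⟨z, hz⟩ : ∃ z, z = (1 / (1 + c)) • (c • ∑ l : Fin n, u' S (l + 1) + c • u' S (n + 1) -
    ε • u' S (n + 2)) := ⟨_, rfl⟩
  have hz' : (1 + c) • z = c • ∑ l : Fin n, u' S (l + 1) + c • u' S (n + 1) - ε • u' S (n + 2) := by
    rw [hz, smul_smul, mul_one_div_cancel (by positivity), one_smul]
  let f : Option (Fin n) → EuclideanSpace ℝ (Fin (n + 1)) :=
    fun o => o.elim (u' S (n + 2) - z) fun i => u' S (i + 1) - z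
  have hf : LinearIndependent ℝ f := by
    rw [Fintype.linearIndependent_iff]
    intro g hg
    rw [Fintype.sum_option] at hg
    simp only [f, Option.elim, smul_sub, Finset.sum_sub_distrib, ← Finset.sum_smul] at hg
    set G : ℝ := ∑ i, g (some i) + g none with hG
    let lam : ℝ := G / (1 + c)
    have hlam : lam * (1 + c) = G := div_mul_cancel₀ _ (by positivity)
    let W : Fin (n + 2) → ℝ := Fin.snoc (α := fun _ => ℝ)
      (Fin.snoc (α := fun _ => ℝ) (fun i : Fin n => g (some i) - lam * c) (-(lam * c)))
      (g none + lam * ε)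
    have hind := affineIndependent_iff.1 S.independent Finset.univ W
    have hz2 : G • z = lam • ((1 + c) • z) := by rw [smul_smul, hlam]
    rw [hz'] at hz2
    have hW : ∀ j, W j = 0 := by
      intro j
      refine hind ?_ ?_ j (Finset.mem_univ _)
      · rw [Fin.sum_univ_castSucc, Fin.sum_univ_castSucc]
        simp only [Fin.snoc_castSucc, Fin.snoc_last, Finset.sum_sub_distrib, Finset.sum_const,
          Finset.card_univ, Fintype.card_fin, nsmul_eq_mul]
        linear_combination -hlam - lam * hnc - hG
      · have e1 : ∀ i : Fin n, S.points i.castSucc.castSucc = u' S (i + 1) := fun i =>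
          (u'_succ S (by omega)).symm
        have e2 : S.points (Fin.last n).castSucc = u' S (n + 1) := (u'_succ S (by omega)).symm
        have e3 : S.points (Fin.last (n + 1)) = u' S (n + 2) :=
          (u'_succ S (j := n + 1) (by omega)).symm
        rw [Fin.sum_univ_castSucc, Fin.sum_univ_castSucc]
        simp only [W, Fin.snoc_castSucc, Fin.snoc_last, e1, e2, e3, sub_smul,
          Finset.sum_sub_distrib, ← Finset.smul_sum]
        have hz3 : (∑ i, g (some i) + g none) • z = lam • (c • ∑ l : Fin n, u' S (l + 1) +
          c • u' S (n + 1) - ε • u' S (n + 2)) := hz2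
        rw [add_smul] at hz3
        linear_combination (norm := module) hg + hz3
    have hlam0 : lam = 0 := by
      have := hW (Fin.last n).castSucc
      simp only [W, Fin.snoc_castSucc, Fin.snoc_last] at this
      have h2 : lam * c = 0 := by linarith
      exact (mul_eq_zero.1 h2).resolve_right hc0.ne'
    rintro (_ | i)
    · have := hW (Fin.last (n + 1))
      simpa [W, hlam0] using this
    · have := hW i.castSucc.castSucc
      simpa only [W, Fin.snoc_castSucc, hlam0, zero_mul, sub_zero] using this
  let b := basisOfLinearIndependentOfCardEqFinrank hf (by simp)
  have hb : ⇑b = f := coe_basisOfLinearIndependentOfCardEqFinrank hf _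
  have hsum : ∑ l : Fin n, u' S (l + 1) = ∑ i, b (some i) + (n : ℝ) • z := by
    simp [hb, f, Finset.sum_sub_distrib, ← Nat.cast_smul_eq_nsmul ℝ]
  refine ⟨z, b, fun i => by simp [hb, f], fun i => ?_, by simp [hb, f], ?_⟩
  · have e : c • b (some i) = c • u' S (i + 1) - c • z := by simp [hb, f, smul_sub]
    have hn2 : (1 + ε) * (1 / n) = c := by rw [hc]; ring
    have e2 : (1 + ε) • p S (i + 1) =
        c • (∑ l : Fin n, u' S (l + 1) + u' S (n + 1) - u' S (i + 1)) := by
      rw [p_succ, smul_smul, hn2]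
    have e3 : u S ε (i + 1) = (1 + ε) • p S (i + 1) - ε • u' S (n + 2) := by
      rw [u]; module
    rw [e3, e2, e]
    linear_combination (norm := module) - hz'
  · have e0 : b none = u' S (n + 2) - z := by simp [hb, f]
    rw [hsum, smul_add, smul_smul, mul_comm c, hnc] at hz'
    have e1 : c • u' S (n + 1) = c • (z - ∑ i, b (some i) + (ε / c) • b none) := by
      rw [smul_add, smul_smul, mul_div_cancel₀ _ hc0.ne', e0]
      linear_combination (norm := module) - hz'
    exact smul_right_injective _ hc0.ne' e1

/-- The shift from `Fin n` to the indices `1, …, n`. -/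
def shift (n : ℕ) : Fin n ↪ ℕ := ⟨fun i => i + 1, fun i j h => by
  rw [Fin.ext_iff]; simpa using h⟩

@[simp] lemma shift_apply (i : Fin n) : shift n i = i + 1 := rfl

lemma mem_Icc_iff_exists {l : ℕ} : l ∈ Set.Icc 1 n ↔ ∃ i : Fin n, (i : ℕ) + 1 = l := by
  rw [Set.mem_Icc]
  constructor
  · rintro ⟨h1, h2⟩
    exact ⟨⟨l - 1, by omega⟩, by simp only; omega⟩
  · rintro ⟨i, rfl⟩
    have := i.2
    omega

lemma affH_map (S : Affine.Simplex ℝ (EuclideanSpace ℝ (Fin (n + 1))) (n + 1)) {ε c : ℝ}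
    {z : EuclideanSpace ℝ (Fin (n + 1))}
    {b : Module.Basis (Option (Fin n)) ℝ (EuclideanSpace ℝ (Fin (n + 1)))}
    (hu' : ∀ i : Fin n, u' S (i + 1) = z + b (some i))
    (hu : ∀ i : Fin n, u S ε (i + 1) = z - c • b (some i)) (I : Finset (Fin n)) :
    affH S ε (I.map (shift n)) = affineSpan ℝ (Set.range (crossFacet z b c I)) := by
  rw [affH]
  congr 1
  ext x
  simp only [Set.mem_union, Set.mem_image, Set.mem_range, Finset.coe_map, Finset.coe_sdiff,
    Set.mem_sdiff, Finset.mem_coe, crossFacet]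
  constructor
  · rintro (⟨_, ⟨i, hi, rfl⟩, rfl⟩ | ⟨l, ⟨hl, hlI⟩, rfl⟩)
    · exact ⟨i, by rw [if_pos hi, shift_apply, hu]⟩
    · obtain ⟨i, rfl⟩ := mem_Icc_iff_exists.1 (by simpa using hl)
      exact ⟨i, by rw [if_neg fun hi => hlI ⟨i, hi, rfl⟩, hu']⟩
  · rintro ⟨i, rfl⟩
    by_cases hi : i ∈ I
    · exact Or.inl ⟨i + 1, ⟨i, hi, rfl⟩, by rw [if_pos hi, hu]⟩
    · refine Or.inr ⟨i + 1, ⟨?_, ?_⟩, by rw [if_neg hi, hu']⟩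
      · simp
      · rintro ⟨l, hl, h⟩
        exact hi ((shift n).injective h ▸ hl)

lemma exists_map_shift {I : Finset ℕ} (hI : I ⊆ Finset.Icc 1 n) :
    ∃ I' : Finset (Fin n), I'.map (shift n) = I := by
  classical
  refine ⟨Finset.univ.filter fun i => shift n i ∈ I, ?_⟩
  ext l
  simp only [Finset.mem_map, Finset.mem_filter, Finset.mem_univ, true_and]
  constructor
  · rintro ⟨i, h, rfl⟩; exact h
  · intro h
    obtain ⟨i, rfl⟩ := mem_Icc_iff_exists.1 (by simpa using hI h)
    exact ⟨i, h, rfl⟩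

lemma isAssociatedSequence_axisPoint
    (S : Affine.Simplex ℝ (EuclideanSpace ℝ (Fin (n + 1))) (n + 1)) {ε c : ℝ}
    {z : EuclideanSpace ℝ (Fin (n + 1))}
    {b : Module.Basis (Option (Fin n)) ℝ (EuclideanSpace ℝ (Fin (n + 1)))} (hc : 0 < c)
    (hβ : ∀ k : ℕ, 1 ≤ k → 0 < k * (1 + 1 / c) - n)
    (hu' : ∀ i : Fin n, u' S (i + 1) = z + b (some i))
    (hu : ∀ i : Fin n, u S ε (i + 1) = z - c • b (some i)) :
    IsAssociatedSequence S ε (axisPoint z b c) := by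
  intro k hk
  have hk' : 1 ≤ k ∧ k < n := by
    rw [Finset.mem_Icc] at hk; omega
  have hβk := (hβ k hk'.1).ne'
  ext x
  simp only [Set.mem_iInter, Finset.mem_powersetCard, Nat.add_sub_cancel, and_imp,
    Set.mem_singleton_iff, SetLike.mem_coe]
  constructor
  · intro hx
    refine eq_axisPoint z b hc hk'.1 hk'.2 hβk fun I hI => ?_
    rw [← affH_map S hu' hu]
    refine hx _ (fun l hl => ?_) (by rw [Finset.card_map, hI])
    obtain ⟨i, -, rfl⟩ := Finset.mem_map.1 hl
    simp
  · rintro rfl I hI hIk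
    obtain ⟨I', rfl⟩ := exists_map_shift hI
    rw [affH_map S hu' hu]
    exact axisPoint_mem_affineSpan z b hc hβk (by rwa [Finset.card_map] at hIk)

lemma vertexSet_eq (hn : 2 ≤ n) (S : Affine.Simplex ℝ (EuclideanSpace ℝ (Fin (n + 1))) (n + 1))
    {ε : ℝ} {v : ℕ → EuclideanSpace ℝ (Fin (n + 1))} (hv1 : v 1 = u' S (n + 1))
    (D : Cap n (EuclideanSpace ℝ (Fin (n + 1))))
    (hpos : ∀ i : Fin n, D.pt (pos i) = u' S (i + 1))
    (hneg : ∀ i : Fin n, D.pt (neg i) = u S ε (i + 1))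
    (hap : ∀ j : Fin n, D.pt (apex j) = if (j : ℕ) = 0 then u' S (n + 2) else v j) :
    u' S '' Set.Icc 1 (n + 1 + 1) ∪ u S ε '' Set.Icc 1 (n + 1 - 1) ∪
      v '' Set.Icc 2 (n + 1 - 2) = Set.range D.pt := by
  ext x
  simp only [Set.mem_union, Set.mem_image, Set.mem_range]
  constructor
  · rintro ((⟨l, ⟨h1, h2⟩, rfl⟩ | ⟨l, hl, rfl⟩) | ⟨l, ⟨h1, h2⟩, rfl⟩)
    · rcases (show l ≤ n ∨ l = n + 1 ∨ l = n + 2 by omega) with h | rfl | rfl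
      · obtain ⟨i, rfl⟩ := mem_Icc_iff_exists.1 (⟨h1, h⟩ : l ∈ Set.Icc 1 n)
        exact ⟨pos i, hpos i⟩
      · exact ⟨apex ⟨1, by omega⟩, by rw [hap]; simp [hv1]⟩
      · exact ⟨apex ⟨0, by omega⟩, by rw [hap]; simp⟩
    · obtain ⟨i, rfl⟩ := mem_Icc_iff_exists.1 (by simpa using hl : l ∈ Set.Icc 1 n)
      exact ⟨neg i, hneg i⟩
    · exact ⟨apex ⟨l, by omega⟩, by rw [hap, if_neg (by simp only; omega)]⟩
  · rintro ⟨i | i | j, rfl⟩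
    · exact Or.inl (Or.inl ⟨i + 1, ⟨by omega, by omega⟩, (hpos i).symm⟩)
    · exact Or.inl (Or.inr ⟨i + 1, ⟨by omega, by omega⟩, (hneg i).symm⟩)
    · have hj := hap j
      split_ifs at hj with h0
      · exact Or.inl (Or.inl ⟨n + 2, ⟨by omega, by omega⟩, hj.symm⟩)
      · by_cases h1 : (j : ℕ) = 1
        · exact Or.inl (Or.inl ⟨n + 1, ⟨by omega, by omega⟩,
            hv1.symm.trans ((congrArg v h1).symm.trans hj.symm)⟩)
        · exact Or.inr ⟨j, ⟨by omega, by omega⟩, hj.symm⟩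

end Simplex
end CrossPolytopeCap

open CrossPolytopeCap in
theorem theorem6p5 (d : ℕ) (hd : 4 ≤ d) :
    ∃ ε₀ : ℝ, 0 < ε₀ ∧
      ∀ S : Affine.Simplex ℝ (EuclideanSpace ℝ (Fin d)) d, S.Regular →
      ∀ ε : ℝ, 0 < ε → ε < ε₀ →
      ∃ a : ℕ → EuclideanSpace ℝ (Fin d), IsAssociatedSequence S ε a ∧
        ∀ v : ℕ → EuclideanSpace ℝ (Fin d), IsAdmissible S a v →
          dim (polytope S ε v) = d ∧
          {x | IsVertex (polytope S ε v) x}.ncard = 3 * (d - 1) ∧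
          IsSimplicial (d - 2) (polytope S ε v) ∧
          IsSimple 2 (polytope S ε v) ∧
          {q : Set (EuclideanSpace ℝ (Fin d)) × EuclideanSpace ℝ (Fin d) |
              (IsFacet (polytope S ε v) q.1 ∧ IsSimplex q.1) ∧
                IsSimpleVertex (polytope S ε v) q.2 ∧ q.2 ∉ q.1} =
            {(convexHull ℝ (u S ε '' Set.Icc 1 (d - 1) ∪ {v (d - 2)}), u' S (d + 1)),
              (convexHull ℝ (u' S '' Set.Icc 1 (d - 1) ∪ {u' S (d + 1)}), v (d - 2))} := by
  obtain ⟨n, rfl⟩ : ∃ n, d = n + 1 := ⟨d - 1, by omega⟩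
  have hn : 3 ≤ n := by omega
  have hn0 : 0 < n := by omega
  have hnR : (3 : ℝ) ≤ n := by exact_mod_cast hn
  -- For smaller `ε` all points common to the facet hulls lie on the negative side of the axis.
  refine ⟨1 / (n - 1), by apply one_div_pos.2; linarith, fun S _ ε hε hε' => ?_⟩
  rw [lt_div_iff₀ (by linarith)] at hε'
  obtain ⟨c, hc⟩ : ∃ c : ℝ, c = (1 + ε) / n := ⟨_, rfl⟩
  have hc0 : 0 < c := by rw [hc]; positivity
  have hnc : n * c = 1 + ε := by rw [hc]; field_simp
  have hcε : 0 < c - ε := by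
    by_contra! h
    have : n * c ≤ n * ε := by gcongr; linarith
    linarith
  have hβ1 : 1 + 1 / c - n = (c - ε) / c := by
    field_simp
    linarith
  have hβ : ∀ k : ℕ, 1 ≤ k → 0 < k * (1 + 1 / c) - n := by
    intro k hk
    have h1 : (1 : ℝ) ≤ k := by exact_mod_cast hk
    have h2 : 0 < (c - ε) / c := by positivity
    have h3 : 1 * (1 + 1 / c) ≤ k * (1 + 1 / c) := by gcongr
    linarith
  obtain ⟨z, b, hu', hu, hw, hg⟩ := exists_frame hn0 S hε hc
  refine ⟨axisPoint z b c, isAssociatedSequence_axisPoint S hc0 hβ hu' hu, fun v hv => ?_⟩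
  obtain ⟨hv1, hv⟩ := hv
  obtain ⟨D, hDz, hDb, hDc, hap⟩ := exists_cap z b hc0 hβ
    (v := fun j => if j = 0 then u' S (n + 2) else v j) (by simpa using hw) (by
      intro j hj
      rcases Nat.eq_zero_or_pos j with rfl | hj0
      · -- The vertex `u'_d` also lies between the first axis point and `u'_{d+1}`.
        refine ⟨(c - ε) / c, ε / c, by positivity, by positivity, by field_simp; ring, ?_⟩
        simp only [if_true, zero_add, one_ne_zero, if_false, hv1, hw, hg, axisPoint,
          Nat.cast_one, one_mul, hβ1]
        have h1 : (c - ε) / c = 1 - ε / c := by field_simp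
        have h2 : (c - ε) / c * (1 / ((c - ε) / c)) = 1 :=
          mul_one_div_cancel (div_pos hcε hc0).ne'
        rw [smul_sub, smul_smul, h2, h1]
        module
      · have := hv (j + 1) (by rw [Finset.mem_Icc]; omega)
        simpa [hj0.ne'] using this)
  have hpos : ∀ i : Fin n, D.pt (pos i) = u' S (i + 1) := fun i => by
    rw [hu', ← hDz, ← hDb]; rfl
  have hneg : ∀ i : Fin n, D.pt (neg i) = u S ε (i + 1) := fun i => by
    rw [hu, ← hDz, ← hDb, ← hDc]; rfl
  have hbody : polytope S ε v = D.body := by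
    rw [polytope, Cap.body, vertexSet_eq (by omega) S hv1 D hpos hneg hap]
  have hlast : D.pt (apex ⟨n - 1, by omega⟩) = v (n + 1 - 2) := by
    rw [hap, if_neg (by simp only; omega)]
    rfl
  have hfirst : D.pt (apex ⟨0, hn0⟩) = u' S (n + 2) := by rw [hap]; simp
  have hfacet1 : D.facet (some Finset.univ) =
      convexHull ℝ (u S ε '' Set.Icc 1 (n + 1 - 1) ∪ {v (n + 1 - 2)}) := by
    rw [Cap.facet]
    congr 1
    ext x
    simp only [Set.mem_image, Set.mem_ofPred_eq, Set.mem_union, Set.mem_singleton_iff]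
    constructor
    · rintro ⟨i | i | j, hk, rfl⟩
      · exact absurd (Finset.mem_univ i) hk
      · exact Or.inl ⟨i + 1, mem_Icc_iff_exists.2 ⟨i, rfl⟩, (hneg i).symm⟩
      · right
        rw [Cap.inc_some_apex, Finset.card_univ, Fintype.card_fin] at hk
        have e : j = ⟨n - 1, by omega⟩ := by rw [Fin.ext_iff]; simp only; omega
        rw [← hlast, e]
    · rintro (⟨l, hl, rfl⟩ | rfl)
      · obtain ⟨i, rfl⟩ := mem_Icc_iff_exists.1 hl
        exact ⟨neg i, by simp, hneg i⟩
      · exact ⟨apex ⟨n - 1, by omega⟩, by simp; omega, hlast⟩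
  have hfacet2 : D.facet (some ∅) =
      convexHull ℝ (u' S '' Set.Icc 1 (n + 1 - 1) ∪ {u' S (n + 1 + 1)}) := by
    rw [Cap.facet]
    congr 1
    ext x
    simp only [Set.mem_image, Set.mem_ofPred_eq, Set.mem_union, Set.mem_singleton_iff]
    constructor
    · rintro ⟨i | i | j, hk, rfl⟩
      · exact Or.inl ⟨i + 1, mem_Icc_iff_exists.2 ⟨i, rfl⟩, (hpos i).symm⟩
      · exact absurd hk (Finset.notMem_empty i)
      · right
        rw [Cap.inc_some_apex, Finset.card_empty] at hk
        have e : j = ⟨0, hn0⟩ := by rw [Fin.ext_iff]; simp only; omega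
        rw [← hfirst, e]
    · rintro (⟨l, hl, rfl⟩ | rfl)
      · obtain ⟨i, rfl⟩ := mem_Icc_iff_exists.1 hl
        exact ⟨pos i, by simp, hpos i⟩
      · exact ⟨apex ⟨0, hn0⟩, by simp, hfirst⟩
  rw [hbody]
  refine ⟨D.dim_body hn0, D.ncard_vertices hn0, D.isSimplicial hn0, D.isSimple_two hn0, ?_⟩
  rw [D.simplex_facet_simple_vertex_pairs hn, hfacet1, hfacet2, hfirst, hlast]
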